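/- **Theorem 4.4 (Oseen iteration).** Let $d\in\{2,3\}$ and let $\Omega\subset\mathbb R^d$ be a bounded open set (in particular, a bounded Lipschitz domain). Put $X=H_0^1(\Omega)^d$, $Z=H_0^1(\Omega)$, $Y=H_0(\mathrm{div},\Omega)$ (closures of the compactly supported smooth functions/fields in $H^1$, resp. $H(\mathrm{div})$), $E=S=L^2_0(\Omega)$, with $$\|(v,K)\|_1^2=\|\nabla v\|_0^2+\|K\|_0^2+\|\nabla\!\cdot K\|_0^2,\qquad \|(q,\psi)\|_0^2=\|q\|_0^2+\|\psi\|_0^2 .$$ There are constants $\lambda_1,\lambda_2,C_\Omega>0$, depending only on $\Omega$, such that $$\|v\|_{L^6}\le\lambda_1\|\nabla v\|_0,\qquad \|v\|_{L^4}^2\le\lambda_2\|\nabla v\|_0^2,\qquad \|v\|_0\le C_\Omega\|\nabla v\|_0\qquad\text{for all } v\in X \text{ and all } v\in Z; \tag{1}$$ let $\lambda_1,\lambda_2,C_\Omega$ be any positive constants satisfying (1). *Data.* Let $Pr,\kappa>0$, $Ra\ge0$, $\mathbf i\in\mathbb R^d$ a unit vector, $B\in L^3(\Omega)^3$ (with $B=(0,0,B_3)$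 if $d=2$; vectors of $\mathbb R^2$ are padded by a zero in cross products), $f\in H^{-1}(\Omega)^d$, $g\in L^2(\Omega)^d$, $\varphi\in H^{-1}(\Omega)$. For $\eta=(u,J)$, $\Phi=(v,K)$, $\omega=(w,M)$ in $X\times Y$, $\chi=(q,\psi)\in E\times S$ and $\theta,r\in Z$ put $$\mathcal A_0(\eta,\Phi)=Pr(\nabla u,\nabla v)+\kappa(J,K)-\kappa(J\times B,v)+\kappa(K\times B,u),\qquad \mathcal A_1(\omega,\eta,\Phi)=\tfrac12((w\cdot\nabla)u,v)-\tfrac12((w\cdot\nabla)v,u),$$ $$\mathcal B(\chi,\Phi)=b_s(q,v)+b_m(\psi,K),\quad b_s(q,v)=-Pr(q,\nabla\!\cdot v),\quad b_m(\psi,K)=-\kappa(\psi,\nabla\!\cdot K),\quad \mathcal Q(\theta,\Phi)=-Pr\,Ra\,(\theta\,\mathbf i,v),$$ $$e(\theta,r)=(\nabla\theta,\nabla r),\quad \mathcal H(\eta,\theta,r)=\tfrac12(u\cdot\nabla\theta,r)-\tfrac12(u\cdot\nabla r,\theta),\quad \langle L,\Phi\rangle=\langle f,v\rangle+\kappa(g,K),\quad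 \Psi(r)=\langle\varphi,r\rangle,$$ $$\|f\|_{-1}=\sup_{0\ne v\in X}\frac{\langle f,v\rangle}{\|\nabla v\|_0},\quad \|L\|_*=(\|f\|_{-1}^2+\kappa^2\|g\|_0^2)^{1/2},\quad \lambda_\psi=\sup_{0\neq r\in Z}\frac{\langle\varphi,r\rangle}{\|\nabla r\|_0},\quad \lambda_q=Pr\,Ra\,C_\Omega^2,$$ $$C_{\min}=\min\{Pr,\kappa\},\quad C_{\max}=2\max\{Pr,\kappa,\kappa\lambda_1\|B\|_{L^3}\},\quad \sigma=\frac{\lambda_2\|L\|_*}{C_{\min}^2}+\frac{\lambda_2\lambda_q\lambda_\psi}{C_{\min}^2}+\frac{\lambda_2\lambda_q\lambda_\psi}{C_{\min}}+\frac{\lambda_2\|L\|_*}{C_{\min}} .$$ *Discrete spaces.* Let $X_h\subset X$, $Y_h\subset Y$, $E_h\subset E$, $S_h\subset S$, $Z_h\subset Z$ be finite-dimensional subspaces with $\nabla\!\cdot Y_h\subset S_h$ and, for some $\beta_s,\beta_m>0$, $$\inf_{0\ne q\in E_h}\sup_{0\ne w\in X_h}\frac{b_s(q,w)}{\|\nabla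 w\|_0\|q\|_0}\ge\beta_s,\qquad \inf_{0\ne\psi\in S_h}\sup_{0\ne K\in Y_h}\frac{b_m(\psi,K)}{\|K\|_{\mathrm{div}}\|\psi\|_0}\ge\beta_m .$$ The discrete problem is to find $(\eta_h,\xi_h,\theta_h)\in(X_h\times Y_h)\times(E_h\times S_h)\times Z_h$ such that for all $(\Phi,\chi,r)$ in the same space $$\mathcal A_0(\eta_h,\Phi)+\mathcal A_1(\eta_h,\eta_h,\Phi)+\mathcal B(\xi_h,\Phi)+\mathcal Q(\theta_h,\Phi)=\langle L,\Phi\rangle,\quad \mathcal B(\chi,\eta_h)=0,\quad e(\theta_h,r)+\mathcal H(\eta_h,\theta_h,r)=\Psi(r).\tag{2}$$ The Oseen iteration computes $(\eta_h^n,\xi_h^n,\theta_h^n)$, $n\ge0$, in this space: for $n=0$ from (2) with the terms $\mathcal A_1$ and $\mathcal H$ omitted, and for $n\ge1$ from $$\mathcal A_0(\eta_h^n,\Phi)+\mathcal A_1(\eta_h^{n-1},\eta_h^n,\Phi)+\mathcal B(\xi_h^n,\Phi)+\mathcal Q(\theta_h^n,\Phi)=\langle L,\Phi\rangle,\quad \mathcal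 B(\chi,\eta_h^n)=0,\quad e(\theta_h^n,r)+\mathcal H(\eta_h^{n-1},\theta_h^n,r)=\Psi(r).$$ *Conclusion.* Assume $\sigma<1$. Then (2) has exactly one solution, the Oseen iteration is well defined (there is exactly one sequence of iterates), and for all $n\ge0$ $$\|\nabla\theta_h^n\|_0\le\lambda_\psi,\qquad \|\eta_h^n\|_1\le\frac{\|L\|_*+\lambda_\psi\lambda_q}{C_{\min}},$$ $$\|\eta_h-\eta_h^n\|_1\le\sigma^{n+1}\,\frac{\|L\|_*+\lambda_q\lambda_\psi}{C_{\min}},\qquad \|\nabla(\theta_h-\theta_h^n)\|_0\le\sigma^{n+1}\lambda_\psi,$$ $$\beta^*\|\xi_h-\xi_h^n\|_0\le(C_{\max}+3C_{\min})\,\sigma^{n+1}\,\frac{\|L\|_*+\lambda_q\lambda_\psi}{C_{\min}},$$ for every constant $\beta^*$ such that $\sup_{0\ne\Phi\in X_h\times Y_h}\mathcal B(\chi,\Phi)/\|\Phi\|_1\ge\beta^*\|\chi\|_0$ for all $\chi\in E_h\times S_h$; moreover $\beta^*=\min\{\beta_s,\beta_m\}>0$ is such a constant. -/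

import Mathlib

open MeasureTheory
open scoped ContDiff Matrix

noncomputable section

namespace IMHD

/-! ### Function spaces on an open set `Ω ⊆ ℝ^d` -/

/-- Points (and vectors) of `ℝ^d` with the Euclidean norm. -/
abbrev Pt (d : ℕ) := EuclideanSpace ℝ (Fin d)

/-- Scalar `L²(Ω)`. -/
abbrev L2S {d : ℕ} (Ω : Set (Pt d)) := Lp ℝ 2 (volume.restrict Ω)

/-- Vector valued `L²(Ω)^d`. -/
abbrev L2V {d : ℕ} (Ω : Set (Pt d)) := Lp (Pt d) 2 (volume.restrict Ω)

/-- `φ ∈ C_c^∞(Ω; F)`. -/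
def IsTest {d : ℕ} {F : Type} [NormedAddCommGroup F] [NormedSpace ℝ F]
    (Ω : Set (Pt d)) (φ : Pt d → F) : Prop :=
  ContDiff ℝ ∞ φ ∧ HasCompactSupport φ ∧ tsupport φ ⊆ Ω

/-- Classical divergence of a vector field. -/
def divergence {d : ℕ} (φ : Pt d → Pt d) (x : Pt d) : ℝ :=
  ∑ i : Fin d, (fderiv ℝ φ x (EuclideanSpace.single i 1)) i

/-- `H₀¹(Ω)`: the closure of `C_c^∞(Ω)` in `H¹(Ω)`. An element is the pair `(v, ∇v)` of a function
in `L²` and its weak gradient in `L²`, so the space is the closure in `L² × (L²)^d` of the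
pairs `(φ, ∇φ)`. (These pairs already form a linear subspace; the span only bundles it.) -/
def H01 {d : ℕ} (Ω : Set (Pt d)) : Submodule ℝ (L2S Ω × L2V Ω) :=
  (Submodule.span ℝ {w | ∃ φ : Pt d → ℝ, IsTest Ω φ ∧
    w.1 =ᵐ[volume.restrict Ω] φ ∧ w.2 =ᵐ[volume.restrict Ω] gradient φ}).topologicalClosure

/-- `H₀(div, Ω)`: the closure of `C_c^∞(Ω)^d` in `H(div, Ω)`. An element is the pair `(K, div K)`
of a vector field in `L²` and its weak divergence in `L²`. -/
def H0div {d : ℕ} (Ω : Set (Pt d)) : Submodule ℝ (L2V Ω × L2S Ω) :=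
  (Submodule.span ℝ {w | ∃ φ : Pt d → Pt d, IsTest Ω φ ∧
    w.1 =ᵐ[volume.restrict Ω] φ ∧ w.2 =ᵐ[volume.restrict Ω] divergence φ}).topologicalClosure

/-- `L₀²(Ω)`: the functions in `L²(Ω)` of mean zero. (On a set of finite measure
the integrability condition is automatic.) -/
def L20 {d : ℕ} (Ω : Set (Pt d)) : Submodule ℝ (L2S Ω) where
  carrier := {q | Integrable q (volume.restrict Ω) ∧ ∫ x in Ω, q x = 0}
  zero_mem' := by
    have h := Lp.coeFn_zero ℝ 2 (volume.restrict Ω)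
    refine ⟨(integrable_zero _ _ _).congr h.symm, ?_⟩
    rw [integral_congr_ae h]; simp
  add_mem' := by
    rintro a b ⟨ha, ha0⟩ ⟨hb, hb0⟩
    have h := Lp.coeFn_add a b
    refine ⟨(ha.add hb).congr h.symm, ?_⟩
    rw [integral_congr_ae h]
    simp only [Pi.add_apply]
    rw [integral_add ha hb, ha0, hb0, add_zero]
  smul_mem' := by
    rintro c a ⟨ha, ha0⟩
    have h := Lp.coeFn_smul c a
    refine ⟨(ha.smul c).congr h.symm, ?_⟩
    rw [integral_congr_ae h]
    simp only [Pi.smul_apply]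
    rw [integral_smul, ha0, smul_zero]

/-- The velocity space `X = H₀¹(Ω)^d`. -/
abbrev Vel {d : ℕ} (Ω : Set (Pt d)) := Fin d → H01 Ω

variable {d : ℕ} {Ω : Set (Pt d)}

/-- The function underlying `r ∈ H₀¹(Ω)`. -/
def fn (r : H01 Ω) : L2S Ω := (r : L2S Ω × L2V Ω).1

/-- The weak gradient of `r ∈ H₀¹(Ω)`. -/
def grad (r : H01 Ω) : L2V Ω := (r : L2S Ω × L2V Ω).2

/-- The field underlying `K ∈ H₀(div, Ω)`. -/
def vec (K : H0div Ω) : L2V Ω := (K : L2V Ω × L2S Ω).1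

/-- The weak divergence of `K ∈ H₀(div, Ω)`. -/
def wdiv (K : H0div Ω) : L2S Ω := (K : L2V Ω × L2S Ω).2

/-- The vector `v(x)` for a velocity field `v`. -/
def velAt (v : Vel Ω) (x : Pt d) : Pt d := WithLp.toLp 2 fun i => fn (v i) x

/-- `(∇·v)(x)` for a velocity field `v`. -/
def velDiv (v : Vel Ω) (x : Pt d) : ℝ := ∑ i, (grad (v i) x) i

/-- `(((u·∇)v)·w)(x)`. -/
def convect (u v w : Vel Ω) (x : Pt d) : ℝ :=
  ∑ i, inner ℝ (velAt u x) (grad (v i) x) * fn (w i) x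

/-- `‖∇r‖₀` for a scalar `r`. -/
def gradNorm (r : H01 Ω) : ℝ := ‖grad r‖

/-- `‖∇v‖₀` for a velocity field `v`. -/
def velGradNorm (v : Vel Ω) : ℝ := Real.sqrt (∑ i, ‖grad (v i)‖ ^ 2)

/-- `‖K‖_div`. -/
def divNorm (K : H0div Ω) : ℝ := Real.sqrt (‖vec K‖ ^ 2 + ‖wdiv K‖ ^ 2)

/-- `‖(v, K)‖₁`. -/
def norm1 (Φ : Vel Ω × H0div Ω) : ℝ := Real.sqrt (velGradNorm Φ.1 ^ 2 + divNorm Φ.2 ^ 2)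

/-- `‖(q, ψ)‖₀`. -/
def norm0 (χ : L20 Ω × L20 Ω) : ℝ := Real.sqrt (‖χ.1‖ ^ 2 + ‖χ.2‖ ^ 2)

/-- `lam1`, `lam2`, `CΩ` are admissible constants, for vector fields in `H₀¹(Ω)^d` and for scalar
functions in `H₀¹(Ω)`, in `‖v‖_{L⁶} ≤ lam1 ‖∇v‖₀`, `‖v‖_{L⁴}² ≤ lam2 ‖∇v‖₀²`, `‖v‖₀ ≤ CΩ ‖∇v‖₀`. -/
structure SobolevConstants (Ω : Set (Pt d)) (lam1 lam2 CΩ : ℝ) : Prop where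
  lam1_pos : 0 < lam1
  lam2_pos : 0 < lam2
  CΩ_pos : 0 < CΩ
  vel_L6 : ∀ v : Vel Ω, eLpNorm (velAt v) 6 (volume.restrict Ω) ≤
    ENNReal.ofReal (lam1 * velGradNorm v)
  vel_L4 : ∀ v : Vel Ω, eLpNorm (velAt v) 4 (volume.restrict Ω) ^ 2 ≤
    ENNReal.ofReal (lam2 * velGradNorm v ^ 2)
  vel_L2 : ∀ v : Vel Ω, eLpNorm (velAt v) 2 (volume.restrict Ω) ≤
    ENNReal.ofReal (CΩ * velGradNorm v)
  scal_L6 : ∀ r : H01 Ω, eLpNorm (fn r) 6 (volume.restrict Ω) ≤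
    ENNReal.ofReal (lam1 * gradNorm r)
  scal_L4 : ∀ r : H01 Ω, eLpNorm (fn r) 4 (volume.restrict Ω) ^ 2 ≤
    ENNReal.ofReal (lam2 * gradNorm r ^ 2)
  scal_L2 : ∀ r : H01 Ω, eLpNorm (fn r) 2 (volume.restrict Ω) ≤
    ENNReal.ofReal (CΩ * gradNorm r)

/-! ### Data of the problem -/

/-- A vector of `ℝ^d`, `d ≤ 3`, written in 3D fashion (padded by zeros). -/
def lift3 (v : Pt d) : Fin 3 → ℝ := fun i => if h : (i : ℕ) < d then v ⟨i, h⟩ else 0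

/-- Physical parameters and source terms. -/
structure Data (Ω : Set (Pt d)) where
  /-- Prandtl number -/
  Pr : ℝ
  /-- Rayleigh number -/
  Ra : ℝ
  /-- coupling number -/
  κ : ℝ
  /-- unit vector of the buoyancy force -/
  ivec : Pt d
  /-- applied magnetic field -/
  B : Pt d → EuclideanSpace ℝ (Fin 3)
  /-- `f ∈ H⁻¹(Ω)^d` -/
  f : StrongDual ℝ (Vel Ω)
  /-- `g ∈ L²(Ω)^d` -/
  g : L2V Ω
  /-- heat source in `H⁻¹(Ω)` -/
  φ : StrongDual ℝ (H01 Ω)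
  Pr_pos : 0 < Pr
  Ra_nonneg : 0 ≤ Ra
  κ_pos : 0 < κ
  norm_ivec : ‖ivec‖ = 1
  B_mem : MemLp B 3 (volume.restrict Ω)
  /-- in two dimensions `B = (0, 0, B₃)` -/
  B_two : d = 2 → ∀ᵐ x ∂(volume.restrict Ω), B x 0 = 0 ∧ B x 1 = 0

namespace Data

variable (D : Data Ω)

/-! ### The bilinear and trilinear forms -/

/-- `a_s(v, w) = Pr (∇v, ∇w)`. -/
def aS (v w : Vel Ω) : ℝ := D.Pr * ∑ i, inner ℝ (grad (v i)) (grad (w i))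

/-- `a_m(F, K) = κ (F, K)`. -/
def aM (F K : H0div Ω) : ℝ := D.κ * inner ℝ (vec F) (vec K)

/-- `b_s(q, v) = -Pr (q, ∇·v)`. -/
def bS (q : L20 Ω) (v : Vel Ω) : ℝ := -D.Pr * ∫ x in Ω, (q : L2S Ω) x * velDiv v x

/-- `b_m(ψ, F) = -κ (ψ, ∇·F)`. -/
def bM (ψ : L20 Ω) (F : H0div Ω) : ℝ := -D.κ * inner ℝ (ψ : L2S Ω) (wdiv F)

/-- `d(K, v) = -κ (K × B, v)`. -/
def dForm (K : H0div Ω) (v : Vel Ω) : ℝ :=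
  -D.κ * ∫ x in Ω, (lift3 (vec K x) ⨯₃ WithLp.ofLp (D.B x)) ⬝ᵥ lift3 (velAt v x)

/-- `A₀((u, J), (v, K))`. -/
def A0 (η Φ : Vel Ω × H0div Ω) : ℝ :=
  D.aS η.1 Φ.1 + D.aM η.2 Φ.2 + D.dForm η.2 Φ.1 - D.dForm Φ.2 η.1

/-- `B((q, ψ), (v, K))`. -/
def Bform (χ : L20 Ω × L20 Ω) (Φ : Vel Ω × H0div Ω) : ℝ := D.bS χ.1 Φ.1 + D.bM χ.2 Φ.2

/-- `Q(θ, (v, K)) = -Pr Ra (θ i, v)`. -/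
def Q (θ : H01 Ω) (Φ : Vel Ω × H0div Ω) : ℝ :=
  -(D.Pr * D.Ra) * ∫ x in Ω, fn θ x * inner ℝ D.ivec (velAt Φ.1 x)

/-- `⟨L, (v, K)⟩ = ⟨f, v⟩ + κ (g, K)`. -/
def L (Φ : Vel Ω × H0div Ω) : ℝ := D.f Φ.1 + D.κ * inner ℝ D.g (vec Φ.2)

/-! ### The constants -/

/-- `‖f‖₋₁`. -/
def fNorm : ℝ := sSup {t | ∃ v : Vel Ω, v ≠ 0 ∧ t = D.f v / velGradNorm v}

/-- `‖L‖_* = (‖f‖₋₁² + κ² ‖g‖²)^{1/2}`. -/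
def Lstar : ℝ := Real.sqrt (D.fNorm ^ 2 + D.κ ^ 2 * ‖D.g‖ ^ 2)

/-- `λ_ψ = ‖φ‖₋₁`. -/
def lamPsi : ℝ := sSup {t | ∃ r : H01 Ω, r ≠ 0 ∧ t = D.φ r / gradNorm r}

/-- `λ_q = Pr Ra CΩ²`. -/
def lamQ (CΩ : ℝ) : ℝ := D.Pr * D.Ra * CΩ ^ 2

/-- `C_min = min {Pr, κ}`. -/
def Cmin : ℝ := min D.Pr D.κ

/-- `C_max = 2 max {Pr, κ, κ λ₁ ‖B‖_{L³}}`. -/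
def Cmax (lam1 : ℝ) : ℝ :=
  2 * max (max D.Pr D.κ) (D.κ * lam1 * (eLpNorm D.B 3 (volume.restrict Ω)).toReal)

/-- The number `σ` of the uniqueness condition `σ < 1`. -/
def sigma (lam2 CΩ : ℝ) : ℝ :=
  lam2 * D.Lstar / D.Cmin ^ 2 + lam2 * D.lamQ CΩ * D.lamPsi / D.Cmin ^ 2
    + lam2 * D.lamQ CΩ * D.lamPsi / D.Cmin + lam2 * D.Lstar / D.Cmin

end Data

/-- `e(θ, r) = (∇θ, ∇r)`. -/
def eForm (θ r : H01 Ω) : ℝ := inner ℝ (grad θ) (grad r)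

/-- `A₁((w, M), (u, J), (v, K)) = ½ ((w·∇)u, v) - ½ ((w·∇)v, u)`. -/
def A1 (w η Φ : Vel Ω × H0div Ω) : ℝ :=
  1 / 2 * (∫ x in Ω, convect w.1 η.1 Φ.1 x) - 1 / 2 * ∫ x in Ω, convect w.1 Φ.1 η.1 x

/-- `H((u, J), θ, r) = ½ ((u·∇)θ, r) - ½ ((u·∇)r, θ)`. -/
def Hform (η : Vel Ω × H0div Ω) (θ r : H01 Ω) : ℝ :=
  1 / 2 * (∫ x in Ω, inner ℝ (velAt η.1 x) (grad θ x) * fn r x)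
    - 1 / 2 * ∫ x in Ω, inner ℝ (velAt η.1 x) (grad r x) * fn θ x

/-! ### Conforming discretization -/

/-- Finite dimensional conforming spaces `X_h ⊆ H₀¹(Ω)^d`, `Y_h ⊆ H₀(div, Ω)`, `E_h, S_h ⊆ L₀²(Ω)`,
`Z_h ⊆ H₀¹(Ω)`. -/
structure Spaces (Ω : Set (Pt d)) where
  X : Submodule ℝ (Vel Ω)
  Y : Submodule ℝ (H0div Ω)
  E : Submodule ℝ (L20 Ω)
  S : Submodule ℝ (L20 Ω)
  Z : Submodule ℝ (H01 Ω)
  finX : FiniteDimensional ℝ X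
  finY : FiniteDimensional ℝ Y
  finE : FiniteDimensional ℝ E
  finS : FiniteDimensional ℝ S
  finZ : FiniteDimensional ℝ Z

/-- A tuple `(η, ξ, θ)` with `η = (u, J)` and `ξ = (p, φ)`. -/
@[ext] structure State (Ω : Set (Pt d)) where
  η : Vel Ω × H0div Ω
  ξ : L20 Ω × L20 Ω
  θ : H01 Ω

namespace Spaces

variable (V : Spaces Ω)

/-- `∇·Y_h ⊆ S_h`. -/
def ChargeConservative : Prop := ∀ K ∈ V.Y, ∃ s ∈ V.S, (s : L2S Ω) = wdiv K

/-- `(η, ξ, θ) ∈ (X_h × Y_h) × (E_h × S_h) × Z_h`. -/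
def Mem (s : State Ω) : Prop :=
  s.η ∈ V.X.prod V.Y ∧ s.ξ ∈ V.E.prod V.S ∧ s.θ ∈ V.Z

/-- Inf-sup condition for `b_s` on `X_h × E_h` with constant `β`. -/
def InfSupS (D : Data Ω) (β : ℝ) : Prop :=
  ∀ q ∈ V.E, q ≠ 0 →
    β ≤ sSup {t | ∃ w ∈ V.X, w ≠ 0 ∧ t = D.bS q w / (velGradNorm w * ‖q‖)}

/-- Inf-sup condition for `b_m` on `Y_h × S_h` with constant `β`. -/
def InfSupM (D : Data Ω) (β : ℝ) : Prop :=
  ∀ ψ ∈ V.S, ψ ≠ 0 →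
    β ≤ sSup {t | ∃ K ∈ V.Y, K ≠ 0 ∧ t = D.bM ψ K / (divNorm K * ‖ψ‖)}

/-- Inf-sup condition for `B` on `(X_h × Y_h) × (E_h × S_h)` with constant `β`. -/
def InfSup (D : Data Ω) (β : ℝ) : Prop :=
  ∀ χ ∈ V.E.prod V.S,
    β * norm0 χ ≤ sSup {t | ∃ Φ ∈ V.X.prod V.Y, Φ ≠ 0 ∧ t = D.Bform χ Φ / norm1 Φ}

/-- `s` solves the discrete (nonlinear) problem. -/
def IsSolution (D : Data Ω) (s : State Ω) : Prop :=
  V.Mem s ∧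
  (∀ Φ ∈ V.X.prod V.Y,
    D.A0 s.η Φ + A1 s.η s.η Φ + D.Bform s.ξ Φ + D.Q s.θ Φ = D.L Φ) ∧
  (∀ χ ∈ V.E.prod V.S, D.Bform χ s.η = 0) ∧
  (∀ r ∈ V.Z, eForm s.θ r + Hform s.η s.θ r = D.φ r)

/-- `s` is the initial value of the iteration: it solves the linear problem without convection. -/
def IsInitial (D : Data Ω) (s : State Ω) : Prop :=
  V.Mem s ∧
  (∀ Φ ∈ V.X.prod V.Y, D.A0 s.η Φ + D.Bform s.ξ Φ + D.Q s.θ Φ = D.L Φ) ∧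
  (∀ χ ∈ V.E.prod V.S, D.Bform χ s.η = 0) ∧
  (∀ r ∈ V.Z, eForm s.θ r = D.φ r)

/-- `s` is the result of one Oseen step from the previous `η`-component `ηprev`. -/
def IsOseenStep (D : Data Ω) (ηprev : Vel Ω × H0div Ω) (s : State Ω) : Prop :=
  V.Mem s ∧
  (∀ Φ ∈ V.X.prod V.Y,
    D.A0 s.η Φ + A1 ηprev s.η Φ + D.Bform s.ξ Φ + D.Q s.θ Φ = D.L Φ) ∧
  (∀ χ ∈ V.E.prod V.S, D.Bform χ s.η = 0) ∧
  (∀ r ∈ V.Z, eForm s.θ r + Hform ηprev s.θ r = D.φ r)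

/-- `it` is the sequence of iterates of the Oseen iteration. -/
def IsOseenIteration (D : Data Ω) (it : ℕ → State Ω) : Prop :=
  V.IsInitial D (it 0) ∧ ∀ n, V.IsOseenStep D (it n).η (it (n + 1))

end Spaces

end IMHD

end

noncomputable section

namespace IMHD

open Filter Topology ENNReal

variable {d : ℕ} {Ω : Set (Pt d)}

/-! Every equation involved has the same shape: the problem linearized at a velocity `w`, where the
nonlinear problem takes `w` to be its own solution, an Oseen step takes the previous iterate, and
the initial problem takes `w = 0`. `A1 w` and `Hform w` are skew-symmetric, so testing with the
solution removes them and gives bounds `lamPsi` and `M = (Lstar + lamPsi * lamQ) / Cmin` that do not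
depend on `w`. Coercivity of `A0` in the full norm holds on the discrete kernel, because `∇·Y_h ⊆
S_h` makes its magnetic fields exactly divergence free.

Subtracting the problems at `w` and `w'` and testing with the difference shows that the solution map
`w ↦ η` is Lipschitz with constant `σ = (1 + 1 / Cmin) * lam2 * M`. For `σ < 1` this is Banach's
fixed point argument: it yields existence, uniqueness and geometric convergence. The temperature
error follows from the velocity error, and the pressure error from the inf-sup condition. Each
linear problem is a square finite-dimensional system, so its uniqueness implies its solvability.

This argument is carried out for an abstract `OseenSystem` (`Step.N_le`, `Step.N_sub_le`,
`exists_step`, `exists_solution`, `iteration_error_le`). The analysis supplies its constants: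
Sobolev inequalities on `H01`, Hölder bounds for the forms, and `infSup_min`. -/

/-! ### Sobolev inequalities on `H01`. -/

/-- Fatou's lemma for `Lᵠ` norms along an `Lᵖ` convergent sequence. -/
theorem eLpNorm_le_of_tendsto_Lp {α F : Type*} [MeasurableSpace α] [NormedAddCommGroup F]
    {μ : Measure α} {p q : ℝ≥0∞} [Fact (1 ≤ p)] {f : ℕ → Lp F p μ} {g : Lp F p μ}
    (hfg : Tendsto f atTop (𝓝 g)) {c : ℕ → ℝ} {C : ℝ} (hc : Tendsto c atTop (𝓝 C))
    (hf : ∀ n, eLpNorm (f n) q μ ≤ ENNReal.ofReal (c n)) :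
    eLpNorm g q μ ≤ ENNReal.ofReal C := by
  obtain ⟨ns, hns, hae⟩ := (tendstoInMeasure_of_tendsto_Lp hfg).exists_seq_tendsto_ae
  refine (Lp.eLpNorm_lim_le_liminf_eLpNorm (fun n => Lp.aestronglyMeasurable (f (ns n))) g
    hae).trans ?_
  have h1 : Tendsto (fun n => ENNReal.ofReal (c (ns n))) atTop (𝓝 (ENNReal.ofReal C)) :=
    (ENNReal.continuous_ofReal.tendsto C).comp (hc.comp hns.tendsto_atTop)
  rw [← h1.liminf_eq]
  exact liminf_le_liminf (Eventually.of_forall fun n => hf (ns n))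

theorem norm_gradient {φ : Pt d → ℝ} (x : Pt d) : ‖gradient φ x‖ = ‖fderiv ℝ φ x‖ := by
  simp [gradient]

/-- The pairs `(φ, ∇φ)` of test functions form a linear subspace. -/
theorem exists_isTest_of_mem_span {w : L2S Ω × L2V Ω}
    (hw : w ∈ Submodule.span ℝ {w : L2S Ω × L2V Ω | ∃ φ : Pt d → ℝ, IsTest Ω φ ∧
      w.1 =ᵐ[volume.restrict Ω] φ ∧ w.2 =ᵐ[volume.restrict Ω] gradient φ}) :
    ∃ φ : Pt d → ℝ, IsTest Ω φ ∧
      w.1 =ᵐ[volume.restrict Ω] φ ∧ w.2 =ᵐ[volume.restrict Ω] gradient φ := by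
  induction hw using Submodule.span_induction with
  | mem w h => exact h
  | zero =>
    refine ⟨0, ⟨contDiff_const, HasCompactSupport.zero, by simp [tsupport]⟩,
      Lp.coeFn_zero _ _ _, ?_⟩
    refine (Lp.coeFn_zero _ _ _).trans (Eventually.of_forall fun x => ?_)
    simp [gradient]
  | add a b _ _ ha hb =>
    obtain ⟨φ, ⟨h1, h2, h3⟩, h4, h5⟩ := ha
    obtain ⟨ψ, ⟨k1, k2, k3⟩, k4, k5⟩ := hb
    refine ⟨φ + ψ, ⟨h1.add k1, h2.add k2, ?_⟩, (Lp.coeFn_add _ _).trans (h4.add k4), ?_⟩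
    · refine (tsupport_add φ ψ).trans (Set.union_subset h3 k3)
    · refine (Lp.coeFn_add _ _).trans ((h5.add k5).trans (Eventually.of_forall fun x => ?_))
      have e1 := (h1.differentiable (by simp)) x
      have e2 := (k1.differentiable (by simp)) x
      simp [gradient, fderiv_add e1 e2]
  | smul c a _ ha =>
    obtain ⟨φ, ⟨h1, h2, h3⟩, h4, h5⟩ := ha
    refine ⟨c • φ, ⟨contDiff_const.smul h1, h2.smul_left (f := fun _ => c), ?_⟩,
      (Lp.coeFn_smul _ _).trans (h4.const_smul c), ?_⟩
    · exact (tsupport_smul_subset_right (fun _ => c) φ).trans h3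
    · refine (Lp.coeFn_smul _ _).trans ((h5.const_smul c).trans (Eventually.of_forall fun x => ?_))
      have e1 := (h1.differentiable (by simp)) x
      simp [gradient, fderiv_const_smul e1 c]

theorem isFiniteMeasure_restrict (hΩb : Bornology.IsBounded Ω) :
    IsFiniteMeasure (volume.restrict Ω) :=
  ⟨by simpa using hΩb.measure_lt_top⟩

/-- Sobolev inequality for test functions. -/
theorem exists_sobolev_isTest (hd : d = 2 ∨ d = 3) (hΩb : Bornology.IsBounded Ω) :
    ∃ C : ℝ, 0 ≤ C ∧ ∀ φ : Pt d → ℝ, IsTest Ω φ → eLpNorm φ 6 (volume.restrict Ω) ≤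
      ENNReal.ofReal C * eLpNorm (gradient φ) 2 (volume.restrict Ω) := by
  have := isFiniteMeasure_restrict hΩb
  -- The Gagliardo–Nirenberg–Sobolev inequality needs `p < d`, and `p ≤ 2` lets Hölder on the
  -- bounded set return to the `L²` norm of the gradient. Both choices give `1/p - 1/d = 1/6`
  -- exactly.
  obtain ⟨p, hp1, hpd, hp2, hp6⟩ : ∃ p : NNReal, 1 ≤ p ∧ p < d ∧ p ≤ 2 ∧
      (p : ℝ)⁻¹ - (d : ℝ)⁻¹ ≤ ((6 : NNReal) : ℝ)⁻¹ := by
    rcases hd with rfl | rfl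
    · refine ⟨3 / 2, ?_, ?_, ?_, ?_⟩
      · rw [le_div_iff₀] <;> norm_num
      · rw [div_lt_iff₀] <;> norm_num
      · rw [div_le_iff₀] <;> norm_num
      · push_cast; norm_num
    · refine ⟨2, ?_, ?_, le_rfl, ?_⟩ <;> norm_num
  have hp2' : (p : ℝ≥0∞) ≤ 2 := by exact_mod_cast hp2
  set K : ℝ≥0∞ := (eLpNormLESNormFDerivOfLeConst ℝ (volume : Measure (Pt d)) Ω p 6 : ℝ≥0∞) *
    (volume.restrict Ω) Set.univ ^ (1 / (p : ℝ≥0∞).toReal - 1 / (2 : ℝ≥0∞).toReal) with hK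
  have hKtop : K ≠ ⊤ := by
    refine ENNReal.mul_ne_top ENNReal.coe_ne_top (ENNReal.rpow_ne_top_of_nonneg ?_
      (measure_ne_top _ _))
    have : (0 : ℝ) < p := lt_of_lt_of_le one_pos (by exact_mod_cast hp1)
    rw [sub_nonneg]
    simp only [ENNReal.coe_toReal, ENNReal.toReal_ofNat]
    exact one_div_le_one_div_of_le this (by exact_mod_cast hp2)
  refine ⟨K.toReal, ENNReal.toReal_nonneg, fun φ hφ => ?_⟩
  rw [ENNReal.ofReal_toReal hKtop]
  obtain ⟨h1, h2, h3⟩ := hφ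
  have hg : eLpNorm (gradient φ) 2 (volume.restrict Ω)
      = eLpNorm (fderiv ℝ φ) 2 (volume.restrict Ω) :=
    eLpNorm_congr_norm_ae (Eventually.of_forall fun x => norm_gradient x)
  have hsub : (fderiv ℝ φ).support ⊆ Ω :=
    (subset_tsupport _).trans ((tsupport_fderiv_subset ℝ).trans h3)
  have hm : AEStronglyMeasurable (fderiv ℝ φ) (volume.restrict Ω) :=
    (h1.continuous_fderiv (by simp)).aestronglyMeasurable
  -- The derivative of a test function vanishes outside `Ω`, so restricting the measure loses
  -- nothing.
  have hres : eLpNorm (fderiv ℝ φ) p volume = eLpNorm (fderiv ℝ φ) p (volume.restrict Ω) := by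
    rw [← eLpNorm_norm, ← eLpNorm_norm (fderiv ℝ φ)]
    refine (eLpNorm_restrict_eq_of_support_subset fun x hx => hsub ?_).symm
    simpa using hx
  calc eLpNorm φ 6 (volume.restrict Ω) ≤ eLpNorm φ 6 volume :=
        eLpNorm_mono_measure _ Measure.restrict_le_self
    _ ≤ eLpNormLESNormFDerivOfLeConst ℝ (volume : Measure (Pt d)) Ω p 6 *
          eLpNorm (fderiv ℝ φ) p volume := by
        have := eLpNorm_le_eLpNorm_fderiv_of_le (q := 6) (volume : Measure (Pt d))
          (h1.of_le (by simp)) ((subset_tsupport _).trans h3) hp1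
          (by simpa using hpd) (by simpa using hp6) hΩb
        exact_mod_cast this
    _ = eLpNormLESNormFDerivOfLeConst ℝ (volume : Measure (Pt d)) Ω p 6 *
          eLpNorm (fderiv ℝ φ) p (volume.restrict Ω) := by
        rw [hres]
    _ ≤ eLpNormLESNormFDerivOfLeConst ℝ (volume : Measure (Pt d)) Ω p 6 *
          (eLpNorm (fderiv ℝ φ) 2 (volume.restrict Ω) * (volume.restrict Ω) Set.univ ^
            (1 / (p : ℝ≥0∞).toReal - 1 / (2 : ℝ≥0∞).toReal)) := by
        gcongr
        exact eLpNorm_le_eLpNorm_mul_rpow_measure_univ hp2' hm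
    _ = K * eLpNorm (gradient φ) 2 (volume.restrict Ω) := by
        rw [hg, hK]; ring

/-- Sobolev inequality on `H₀¹(Ω)`. -/
theorem exists_sobolev_H01 (hd : d = 2 ∨ d = 3) (hΩb : Bornology.IsBounded Ω) :
    ∃ C : ℝ, 0 ≤ C ∧ ∀ r : H01 Ω, eLpNorm (fn r) 6 (volume.restrict Ω) ≤
      ENNReal.ofReal (C * gradNorm r) := by
  obtain ⟨C, hC, h⟩ := exists_sobolev_isTest hd hΩb
  refine ⟨C, hC, fun r => ?_⟩
  obtain ⟨w, hw, hwr⟩ := mem_closure_iff_seq_limit.1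
    (show (r : L2S Ω × L2V Ω) ∈ closure _ from r.2)
  have h1 : Tendsto (fun n => (w n).1) atTop (𝓝 (fn r)) :=
    (continuous_fst.tendsto _).comp hwr
  have h2 : Tendsto (fun n => (w n).2) atTop (𝓝 (grad r)) :=
    (continuous_snd.tendsto _).comp hwr
  -- Approximants converge only in `L²`, where the `L⁶` norm is lower semicontinuous; that is enough
  -- for an upper bound.
  refine eLpNorm_le_of_tendsto_Lp h1 (h2.norm.const_mul C) fun n => ?_
  obtain ⟨φ, hφ, e1, e2⟩ := exists_isTest_of_mem_span (hw n)
  rw [eLpNorm_congr_ae e1]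
  refine (h φ hφ).trans_eq ?_
  rw [← eLpNorm_congr_ae e2, ENNReal.ofReal_mul hC, ofReal_norm, Lp.enorm_def]

theorem aestronglyMeasurable_velAt (v : Vel Ω) :
    AEStronglyMeasurable (velAt v) (volume.restrict Ω) := by
  have h : AEStronglyMeasurable (fun x => fun i => (fn (v i) : Pt d → ℝ) x)
      (volume.restrict Ω) :=
    (aemeasurable_pi_lambda _ fun i =>
      (Lp.aestronglyMeasurable (fn (v i))).aemeasurable).aestronglyMeasurable
  exact (PiLp.continuous_toLp 2 (fun _ : Fin d => ℝ)).comp_aestronglyMeasurable h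

theorem norm_grad_le_velGradNorm (v : Vel Ω) (i : Fin d) : ‖grad (v i)‖ ≤ velGradNorm v :=
  Real.le_sqrt_of_sq_le
    (Finset.single_le_sum (f := fun i => ‖grad (v i)‖ ^ 2) (fun _ _ => sq_nonneg _)
      (Finset.mem_univ i))

theorem velGradNorm_nonneg (v : Vel Ω) : 0 ≤ velGradNorm v := Real.sqrt_nonneg _

theorem gradNorm_nonneg (r : H01 Ω) : 0 ≤ gradNorm r := norm_nonneg _

/-- Componentwise bounds imply a bound for the vector field. -/
theorem eLpNorm_velAt_le {q : ℝ≥0∞} (hq : 1 ≤ q) {C : ℝ} (hC : 0 ≤ C)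
    (h : ∀ r : H01 Ω, eLpNorm (fn r) q (volume.restrict Ω) ≤ ENNReal.ofReal (C * gradNorm r))
    (v : Vel Ω) : eLpNorm (velAt v) q (volume.restrict Ω) ≤
      ENNReal.ofReal (d * C * velGradNorm v) := by
  have h1 : eLpNorm (velAt v) q (volume.restrict Ω) ≤
      eLpNorm (∑ i, fun x => ‖fn (v i) x‖) q (volume.restrict Ω) := by
    refine eLpNorm_mono_real fun x => ?_
    rw [Finset.sum_apply]
    have e : velAt v x = ∑ i, fn (v i) x • EuclideanSpace.single i (1 : ℝ) := by
      ext j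
      simp [velAt, Pi.single_apply]
    rw [e]
    refine (norm_sum_le _ _).trans_eq ?_
    simp [norm_smul]
  refine h1.trans ((eLpNorm_sum_le (fun i _ => (Lp.aestronglyMeasurable _).norm) hq).trans ?_)
  calc ∑ i, eLpNorm (fun x => ‖fn (v i) x‖) q (volume.restrict Ω)
      ≤ ∑ i : Fin d, ENNReal.ofReal (C * velGradNorm v) := by
        refine Finset.sum_le_sum fun i _ => ?_
        rw [eLpNorm_norm]
        refine (h (v i)).trans (ENNReal.ofReal_le_ofReal ?_)
        exact mul_le_mul_of_nonneg_left (norm_grad_le_velGradNorm v i) hC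
    _ = ENNReal.ofReal (d * C * velGradNorm v) := by
        rw [Finset.sum_const, Finset.card_univ, Fintype.card_fin, nsmul_eq_mul, mul_assoc,
          ENNReal.ofReal_mul (Nat.cast_nonneg d), ENNReal.ofReal_natCast]

/-- Lower exponents on a set of finite measure. -/
theorem exists_eLpNorm_fn_le (hΩb : Bornology.IsBounded Ω) {C : ℝ} (hC : 0 ≤ C)
    (h : ∀ r : H01 Ω, eLpNorm (fn r) 6 (volume.restrict Ω) ≤ ENNReal.ofReal (C * gradNorm r))
    {q : ℝ≥0∞} (hq1 : 1 ≤ q) (hq : q ≤ 6) :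
    ∃ C' : ℝ, 0 ≤ C' ∧ ∀ r : H01 Ω, eLpNorm (fn r) q (volume.restrict Ω) ≤
      ENNReal.ofReal (C' * gradNorm r) := by
  have := isFiniteMeasure_restrict hΩb
  have hqt : q ≠ ⊤ := ne_top_of_le_ne_top (by simp) hq
  have hq0 : 0 < q.toReal := ENNReal.toReal_pos (one_pos.trans_le hq1).ne' hqt
  set K := (volume.restrict Ω) Set.univ ^ (1 / q.toReal - 1 / (6 : ℝ≥0∞).toReal) with hK
  have hKt : K ≠ ⊤ := by
    refine ENNReal.rpow_ne_top_of_nonneg ?_ (measure_ne_top _ _)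
    rw [sub_nonneg]
    exact one_div_le_one_div_of_le hq0 (ENNReal.toReal_mono (by simp) hq)
  refine ⟨C * K.toReal, by positivity, fun r => ?_⟩
  refine (eLpNorm_le_eLpNorm_mul_rpow_measure_univ hq (Lp.aestronglyMeasurable _)).trans ?_
  rw [← hK]
  calc _ ≤ ENNReal.ofReal (C * gradNorm r) * ENNReal.ofReal K.toReal := by
        rw [ENNReal.ofReal_toReal hKt]; gcongr; exact h r
    _ = _ := by
        rw [← ENNReal.ofReal_mul (mul_nonneg hC (gradNorm_nonneg r))]
        ring_nf

theorem exists_sobolevConstants (hd : d = 2 ∨ d = 3) (hΩb : Bornology.IsBounded Ω) :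
    ∃ lam1 lam2 CΩ : ℝ, SobolevConstants Ω lam1 lam2 CΩ := by
  obtain ⟨C, hC, h6⟩ := exists_sobolev_H01 hd hΩb
  obtain ⟨C4, hC4, h4⟩ := exists_eLpNorm_fn_le hΩb hC h6 (q := 4) (by norm_num) (by norm_num)
  obtain ⟨C2, hC2, h2⟩ := exists_eLpNorm_fn_le hΩb hC h6 (q := 2) (by norm_num) (by norm_num)
  have hsq : ∀ {a : ℝ≥0∞} {c D g : ℝ}, 0 ≤ c → 0 ≤ g → a ≤ ENNReal.ofReal (c * g) → c ≤ D →
      a ^ 2 ≤ ENNReal.ofReal (D ^ 2 * g ^ 2) := by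
    intro a c D g hc hg ha hcD
    rw [← mul_pow, ENNReal.ofReal_pow (by nlinarith)]
    gcongr
    exact ha.trans (ENNReal.ofReal_le_ofReal (by gcongr))
  have hd1 : (1 : ℝ) ≤ d := by rcases hd with rfl | rfl <;> norm_num
  -- The factor `d` pays for the sum over components, and `+ 1` makes the constants strictly
  -- positive.
  refine ⟨d * C + 1, (d * C4 + 1) ^ 2, d * C2 + 1, ⟨by positivity, by positivity, by positivity,
    fun v => ?_, fun v => ?_, fun v => ?_, fun r => ?_, fun r => ?_, fun r => ?_⟩⟩
  · refine (eLpNorm_velAt_le (by norm_num) hC h6 v).trans (ENNReal.ofReal_le_ofReal ?_)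
    nlinarith [velGradNorm_nonneg v]
  · exact hsq (by positivity) (velGradNorm_nonneg v) (eLpNorm_velAt_le (by norm_num) hC4 h4 v)
      (by linarith)
  · refine (eLpNorm_velAt_le (by norm_num) hC2 h2 v).trans (ENNReal.ofReal_le_ofReal ?_)
    nlinarith [velGradNorm_nonneg v]
  · refine (h6 r).trans (ENNReal.ofReal_le_ofReal ?_)
    exact mul_le_mul_of_nonneg_right (by nlinarith) (gradNorm_nonneg r)
  · exact hsq hC4 (gradNorm_nonneg r) (h4 r) (by nlinarith)
  · refine (h2 r).trans (ENNReal.ofReal_le_ofReal ?_)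
    exact mul_le_mul_of_nonneg_right (by nlinarith) (gradNorm_nonneg r)

/-! ### Hölder inequalities for integrals -/

/-- Integrability is recorded with the bound because additivity of the forms below depends on it.
Only pointwise domination of `G` is required, which covers inner products and triple products alike.
-/
theorem integrable_and_abs_integral_le_mul {α E F : Type*} [MeasurableSpace α]
    [NormedAddCommGroup E] [NormedAddCommGroup F] {μ : Measure α} {p q : ℝ≥0∞}
    [HolderTriple p q 1] {f : α → E} {g : α → F} (hf : MemLp f p μ) (hg : MemLp g q μ)
    {G : α → ℝ} (hG : AEStronglyMeasurable G μ) (hb : ∀ᵐ x ∂μ, ‖G x‖ ≤ ‖f x‖ * ‖g x‖) :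
    Integrable G μ ∧ |∫ x, G x ∂μ| ≤ (eLpNorm f p μ).toReal * (eLpNorm g q μ).toReal := by
  have h1 : eLpNorm G 1 μ ≤ eLpNorm f p μ * eLpNorm g q μ := by
    refine (eLpNorm_mono_ae_real hb).trans ?_
    have := eLpNorm_smul_le_mul_eLpNorm (p := p) (q := q) (r := 1) hg.norm.1 hf.norm.1
    rwa [eLpNorm_norm, eLpNorm_norm] at this
  have h2 : eLpNorm f p μ * eLpNorm g q μ ≠ ⊤ := ENNReal.mul_ne_top hf.2.ne hg.2.ne
  have hi : Integrable G μ := memLp_one_iff_integrable.1 ⟨hG, h1.trans_lt h2.lt_top⟩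
  refine ⟨hi, ?_⟩
  rw [← ENNReal.toReal_mul]
  refine le_trans ?_ (ENNReal.toReal_mono h2 h1)
  rw [eLpNorm_one_eq_lintegral_enorm, ← integral_norm_eq_lintegral_enorm hG]
  exact norm_integral_le_integral_norm G

/-- Hölder is applied twice: the first two factors are merged into exponent `s`, which is then
paired with `r`. -/
theorem integrable_and_abs_integral_le_mul_mul {α E F E' : Type*} [MeasurableSpace α]
    [NormedAddCommGroup E] [NormedAddCommGroup F] [NormedAddCommGroup E'] {μ : Measure α}
    {p q r s : ℝ≥0∞} [HolderTriple p q s] [HolderTriple s r 1] {f : α → E} {g : α → F}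
    {h : α → E'} (hf : MemLp f p μ) (hg : MemLp g q μ) (hh : MemLp h r μ) {G : α → ℝ}
    (hG : AEStronglyMeasurable G μ) (hb : ∀ᵐ x ∂μ, ‖G x‖ ≤ ‖f x‖ * ‖g x‖ * ‖h x‖) :
    Integrable G μ ∧ |∫ x, G x ∂μ| ≤
      (eLpNorm f p μ).toReal * (eLpNorm g q μ).toReal * (eLpNorm h r μ).toReal := by
  have hfg : MemLp (fun x => ‖f x‖ * ‖g x‖) s μ := hg.norm.mul' hf.norm
  obtain ⟨h1, h2⟩ := integrable_and_abs_integral_le_mul hfg hh hG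
    (hb.mono fun x hx => by simpa [abs_mul] using hx)
  refine ⟨h1, h2.trans (mul_le_mul_of_nonneg_right ?_ ENNReal.toReal_nonneg)⟩
  rw [← ENNReal.toReal_mul]
  refine ENNReal.toReal_mono (ENNReal.mul_ne_top hf.2.ne hg.2.ne) ?_
  have := eLpNorm_smul_le_mul_eLpNorm (p := p) (q := q) (r := s) hg.norm.1 hf.norm.1
  rwa [eLpNorm_norm, eLpNorm_norm] at this

theorem holderTriple_of_toReal {p q r : ℝ≥0∞} (hp : p ≠ 0) (hq : q ≠ 0) (hr : r ≠ 0)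
    (h : p.toReal⁻¹ + q.toReal⁻¹ = r.toReal⁻¹) : HolderTriple p q r := by
  refine ⟨?_⟩
  have hp' : p⁻¹ ≠ ⊤ := by simpa using hp
  have hq' : q⁻¹ ≠ ⊤ := by simpa using hq
  have hr' : r⁻¹ ≠ ⊤ := by simpa using hr
  rw [← ENNReal.toReal_eq_toReal_iff' (ENNReal.add_ne_top.2 ⟨hp', hq'⟩) hr',
    ENNReal.toReal_add hp' hq', ENNReal.toReal_inv, ENNReal.toReal_inv, ENNReal.toReal_inv, h]

/-- Exponents `4, 2, 4` serve convection and `2, 3, 6` serve the Lorentz force; `4/3` and `6/5` are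
the intermediate exponents. -/
instance holderTriple_four_two : HolderTriple 4 2 (4 / 3) :=
  holderTriple_of_toReal (by simp) (by simp) (by simp) (by simp; norm_num)
instance holderTriple_four_thirds_four : HolderTriple (4 / 3) 4 1 :=
  holderTriple_of_toReal (by simp) (by simp) (by simp) (by simp; norm_num)
instance holderTriple_two_three : HolderTriple 2 3 (6 / 5) :=
  holderTriple_of_toReal (by simp) (by simp) (by simp) (by simp; norm_num)
instance holderTriple_six_fifths_six : HolderTriple (6 / 5) 6 1 :=
  holderTriple_of_toReal (by simp) (by simp) (by simp) (by simp; norm_num)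

/-! ### Linearity of the components -/

section Components

@[simp] theorem fn_add (a b : H01 Ω) : fn (a + b) = fn a + fn b := rfl
@[simp] theorem fn_smul (c : ℝ) (a : H01 Ω) : fn (c • a) = c • fn a := rfl
@[simp] theorem grad_add (a b : H01 Ω) : grad (a + b) = grad a + grad b := rfl
@[simp] theorem grad_smul (c : ℝ) (a : H01 Ω) : grad (c • a) = c • grad a := rfl
@[simp] theorem vec_add (a b : H0div Ω) : vec (a + b) = vec a + vec b := rfl
@[simp] theorem vec_smul (c : ℝ) (a : H0div Ω) : vec (c • a) = c • vec a := rfl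
@[simp] theorem wdiv_add (a b : H0div Ω) : wdiv (a + b) = wdiv a + wdiv b := rfl
@[simp] theorem wdiv_smul (c : ℝ) (a : H0div Ω) : wdiv (c • a) = c • wdiv a := rfl

theorem velAt_add (u v : Vel Ω) :
    velAt (u + v) =ᵐ[volume.restrict Ω] fun x => velAt u x + velAt v x := by
  have h : ∀ᵐ x ∂(volume.restrict Ω), ∀ i, fn ((u + v) i) x = fn (u i) x + fn (v i) x :=
    ae_all_iff.2 fun i => Lp.coeFn_add (fn (u i)) (fn (v i))
  filter_upwards [h] with x hx
  ext i
  simpa [velAt] using hx i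

theorem velAt_smul (c : ℝ) (u : Vel Ω) :
    velAt (c • u) =ᵐ[volume.restrict Ω] fun x => c • velAt u x := by
  have h : ∀ᵐ x ∂(volume.restrict Ω), ∀ i, fn ((c • u) i) x = c * fn (u i) x :=
    ae_all_iff.2 fun i => Lp.coeFn_smul c (fn (u i))
  filter_upwards [h] with x hx
  ext i
  simpa [velAt] using hx i

end Components

/-! ### The transport and Lorentz integrals and their homogeneity. -/

/-- The integral `((u·∇)θ, r)`. -/
def transportInt (u : Vel Ω) (θ r : H01 Ω) : ℝ :=
  ∫ x in Ω, inner ℝ (velAt u x) (grad θ x) * fn r x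

/-- The integral `(K × B, v)`. -/
def lorentzInt (B : Pt d → EuclideanSpace ℝ (Fin 3)) (K : H0div Ω) (v : Vel Ω) : ℝ :=
  ∫ x in Ω, (lift3 (vec K x) ⨯₃ WithLp.ofLp (B x)) ⬝ᵥ lift3 (velAt v x)

theorem transportInt_smul_vel (c : ℝ) (u : Vel Ω) (θ r : H01 Ω) :
    transportInt (c • u) θ r = c * transportInt u θ r := by
  unfold transportInt
  rw [← integral_const_mul]
  refine integral_congr_ae ?_
  filter_upwards [velAt_smul c u] with x hx
  rw [hx, real_inner_smul_left, mul_assoc]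

theorem transportInt_smul_left (c : ℝ) (u : Vel Ω) (a r : H01 Ω) :
    transportInt u (c • a) r = c * transportInt u a r := by
  unfold transportInt
  rw [← integral_const_mul]
  refine integral_congr_ae ?_
  rw [grad_smul]
  filter_upwards [Lp.coeFn_smul c (grad a)] with x hx
  rw [hx, Pi.smul_apply, real_inner_smul_right, mul_assoc]

theorem transportInt_smul_right (c : ℝ) (u : Vel Ω) (θ a : H01 Ω) :
    transportInt u θ (c • a) = c * transportInt u θ a := by
  unfold transportInt
  rw [← integral_const_mul]
  refine integral_congr_ae ?_
  rw [fn_smul]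
  filter_upwards [Lp.coeFn_smul c (fn a)] with x hx
  rw [hx, Pi.smul_apply, smul_eq_mul, mul_left_comm]

/-! ### Consequences of the Sobolev inequalities -/

namespace SobolevConstants

variable {lam1 lam2 CΩ : ℝ}

/-- The `L⁴` inequality is given in squared form; its root carries `√lam2`, and two such factors
restore `lam2`. -/
theorem toReal_le_of_sq_le {a : ℝ≥0∞} {l g : ℝ} (hl : 0 ≤ l) (hg : 0 ≤ g)
    (h : a ^ 2 ≤ ENNReal.ofReal (l * g ^ 2)) : a ≠ ⊤ ∧ a.toReal ≤ √l * g := by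
  have h1 : a ^ 2 ≠ ⊤ := ne_top_of_le_ne_top ENNReal.ofReal_ne_top h
  refine ⟨fun h2 => h1 (by simp [h2]), ?_⟩
  have h3 := ENNReal.toReal_mono ENNReal.ofReal_ne_top h
  rw [ENNReal.toReal_ofReal (by positivity), ENNReal.toReal_pow] at h3
  refine (Real.le_sqrt_of_sq_le h3).trans_eq ?_
  rw [Real.sqrt_mul hl, Real.sqrt_sq hg]

variable (h : SobolevConstants Ω lam1 lam2 CΩ)
include h

theorem memLp_velAt_four (v : Vel Ω) : MemLp (velAt v) 4 (volume.restrict Ω) :=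
  ⟨aestronglyMeasurable_velAt v,
    (toReal_le_of_sq_le h.lam2_pos.le (velGradNorm_nonneg v) (h.vel_L4 v)).1.lt_top⟩

theorem memLp_velAt_six (v : Vel Ω) : MemLp (velAt v) 6 (volume.restrict Ω) :=
  ⟨aestronglyMeasurable_velAt v, (h.vel_L6 v).trans_lt ENNReal.ofReal_lt_top⟩

theorem memLp_fn_four (r : H01 Ω) : MemLp (fn r) 4 (volume.restrict Ω) :=
  ⟨Lp.aestronglyMeasurable _,
    (toReal_le_of_sq_le h.lam2_pos.le (gradNorm_nonneg r) (h.scal_L4 r)).1.lt_top⟩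

theorem norm_fn_le (r : H01 Ω) : ‖fn r‖ ≤ CΩ * ‖grad r‖ := by
  have := ENNReal.toReal_mono ENNReal.ofReal_ne_top (h.scal_L2 r)
  rwa [ENNReal.toReal_ofReal (mul_nonneg h.CΩ_pos.le (gradNorm_nonneg r)), ← Lp.norm_def] at this

/-- Hölder with exponents `4, 2, 4`, using the `L⁴` inequality for `u` and for `r`. -/
theorem integrable_and_abs_transport_le (u : Vel Ω) (θ r : H01 Ω) :
    Integrable (fun x => inner ℝ (velAt u x) (grad θ x) * fn r x) (volume.restrict Ω) ∧
    |∫ x in Ω, inner ℝ (velAt u x) (grad θ x) * fn r x| ≤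
      lam2 * velGradNorm u * ‖grad θ‖ * ‖grad r‖ := by
  obtain ⟨h1, h2⟩ := integrable_and_abs_integral_le_mul_mul (s := 4 / 3)
    (G := fun x => inner ℝ (velAt u x) (grad θ x) * fn r x)
    (h.memLp_velAt_four u) (Lp.memLp (grad θ)) (h.memLp_fn_four r)
    (((aestronglyMeasurable_velAt u).inner (Lp.aestronglyMeasurable _)).mul
      (Lp.aestronglyMeasurable _))
    (Eventually.of_forall fun x => by
      rw [norm_mul]
      exact mul_le_mul_of_nonneg_right (norm_inner_le_norm _ _) (norm_nonneg _))
  refine ⟨h1, h2.trans ?_⟩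
  have e1 := (toReal_le_of_sq_le h.lam2_pos.le (velGradNorm_nonneg u) (h.vel_L4 u)).2
  have e2 := (toReal_le_of_sq_le h.lam2_pos.le (gradNorm_nonneg r) (h.scal_L4 r)).2
  rw [← Lp.norm_def (grad θ)]
  calc _ ≤ (√lam2 * velGradNorm u) * ‖grad θ‖ * (√lam2 * gradNorm r) := by
        have := velGradNorm_nonneg u
        gcongr
    _ = (√lam2 * √lam2) * velGradNorm u * ‖grad θ‖ * ‖grad r‖ := by
        rw [gradNorm]; ring
    _ = _ := by rw [Real.mul_self_sqrt h.lam2_pos.le]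

theorem transportInt_add_vel (u v : Vel Ω) (θ r : H01 Ω) :
    transportInt (u + v) θ r = transportInt u θ r + transportInt v θ r := by
  unfold transportInt
  rw [← integral_add (h.integrable_and_abs_transport_le u θ r).1
      (h.integrable_and_abs_transport_le v θ r).1]
  refine integral_congr_ae ?_
  filter_upwards [velAt_add u v] with x hx
  rw [hx, inner_add_left, add_mul]

theorem transportInt_add_left (u : Vel Ω) (a b r : H01 Ω) :
    transportInt u (a + b) r = transportInt u a r + transportInt u b r := by
  unfold transportInt
  rw [← integral_add (h.integrable_and_abs_transport_le u a r).1
    (h.integrable_and_abs_transport_le u b r).1]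
  refine integral_congr_ae ?_
  rw [grad_add]
  filter_upwards [Lp.coeFn_add (grad a) (grad b)] with x hx
  rw [hx, Pi.add_apply, inner_add_right, add_mul]

theorem transportInt_add_right (u : Vel Ω) (θ a b : H01 Ω) :
    transportInt u θ (a + b) = transportInt u θ a + transportInt u θ b := by
  unfold transportInt
  rw [← integral_add (h.integrable_and_abs_transport_le u θ a).1
    (h.integrable_and_abs_transport_le u θ b).1]
  refine integral_congr_ae ?_
  rw [fn_add]
  filter_upwards [Lp.coeFn_add (fn a) (fn b)] with x hx
  rw [hx, Pi.add_apply, mul_add]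

/-- The trilinear form `((u·∇)θ, r)`. -/
def transport : Vel Ω →ₗ[ℝ] H01 Ω →ₗ[ℝ] H01 Ω →ₗ[ℝ] ℝ where
  toFun u := LinearMap.mk₂ ℝ (transportInt u) (h.transportInt_add_left u)
    (fun c => transportInt_smul_left c u) (h.transportInt_add_right u)
    (fun c => transportInt_smul_right c u)
  map_add' u v := LinearMap.ext₂ fun θ r => h.transportInt_add_vel u v θ r
  map_smul' c u := LinearMap.ext₂ fun θ r => transportInt_smul_vel c u θ r

theorem abs_transport_le (u : Vel Ω) (θ r : H01 Ω) :
    |h.transport u θ r| ≤ lam2 * velGradNorm u * ‖grad θ‖ * ‖grad r‖ :=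
  (h.integrable_and_abs_transport_le u θ r).2

theorem integral_convect (u v w : Vel Ω) :
    ∫ x in Ω, convect u v w x = ∑ i, h.transport u (v i) (w i) := by
  simp only [convect]
  rw [integral_finsetSum _ fun i _ => (h.integrable_and_abs_transport_le u (v i) (w i)).1]
  rfl

end SobolevConstants

/-! ### Elementary relations between the norms. -/

theorem sq_velGradNorm (v : Vel Ω) : velGradNorm v ^ 2 = ∑ i, ‖grad (v i)‖ ^ 2 :=
  Real.sq_sqrt (Finset.sum_nonneg fun _ _ => sq_nonneg _)

theorem sum_norm_grad_mul_le (v w : Vel Ω) :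
    ∑ i, ‖grad (v i)‖ * ‖grad (w i)‖ ≤ velGradNorm v * velGradNorm w :=
  Real.sum_mul_le_sqrt_mul_sqrt _ _ _

theorem sq_divNorm (K : H0div Ω) : divNorm K ^ 2 = ‖vec K‖ ^ 2 + ‖wdiv K‖ ^ 2 :=
  Real.sq_sqrt (by positivity)

theorem divNorm_nonneg (K : H0div Ω) : 0 ≤ divNorm K := Real.sqrt_nonneg _

theorem norm_vec_le (K : H0div Ω) : ‖vec K‖ ≤ divNorm K :=
  Real.le_sqrt_of_sq_le (by nlinarith [sq_nonneg ‖wdiv K‖])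

theorem norm_wdiv_le (K : H0div Ω) : ‖wdiv K‖ ≤ divNorm K :=
  Real.le_sqrt_of_sq_le (by nlinarith [sq_nonneg ‖vec K‖])

theorem sq_norm1 (Φ : Vel Ω × H0div Ω) :
    norm1 Φ ^ 2 = velGradNorm Φ.1 ^ 2 + divNorm Φ.2 ^ 2 :=
  Real.sq_sqrt (by positivity)

theorem norm1_nonneg (Φ : Vel Ω × H0div Ω) : 0 ≤ norm1 Φ := Real.sqrt_nonneg _

theorem velGradNorm_le_norm1 (Φ : Vel Ω × H0div Ω) : velGradNorm Φ.1 ≤ norm1 Φ :=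
  Real.le_sqrt_of_sq_le (by nlinarith [sq_nonneg (divNorm Φ.2)])

theorem divNorm_le_norm1 (Φ : Vel Ω × H0div Ω) : divNorm Φ.2 ≤ norm1 Φ :=
  Real.le_sqrt_of_sq_le (by nlinarith [sq_nonneg (velGradNorm Φ.1)])

/-! ### The padded triple product -/

theorem lift3_add (a b : Pt d) : lift3 (a + b) = lift3 a + lift3 b := by
  ext i
  by_cases hi : (i : ℕ) < d <;> simp [lift3, hi]

theorem lift3_smul (c : ℝ) (a : Pt d) : lift3 (c • a) = c • lift3 a := by
  ext i
  by_cases hi : (i : ℕ) < d <;> simp [lift3, hi]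

theorem continuous_lift3 : Continuous (lift3 : Pt d → Fin 3 → ℝ) := by
  refine continuous_pi fun i => ?_
  by_cases hi : (i : ℕ) < d
  · simp only [lift3, hi, dite_true]; fun_prop
  · simp only [lift3, hi, dite_false]; fun_prop

/-- Padding by zeros preserves the Euclidean length. The restriction on `d` matters: for `d > 3`
coordinates would be cut off. -/
theorem sum_sq_lift3 (hd : d = 2 ∨ d = 3) (a : Pt d) :
    lift3 a 0 ^ 2 + lift3 a 1 ^ 2 + lift3 a 2 ^ 2 = ‖a‖ ^ 2 := by
  rcases hd with rfl | rfl
  · simp [lift3, EuclideanSpace.real_norm_sq_eq, Fin.sum_univ_two]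
  · simp [lift3, EuclideanSpace.real_norm_sq_eq, Fin.sum_univ_three]

theorem cross_dot_eq (a b c : Fin 3 → ℝ) : (a ⨯₃ b) ⬝ᵥ c =
    (a 1 * b 2 - a 2 * b 1) * c 0 + (a 2 * b 0 - a 0 * b 2) * c 1
      + (a 0 * b 1 - a 1 * b 0) * c 2 := by
  simp [cross_apply, dotProduct, Fin.sum_univ_three]

/-- Cauchy–Schwarz combined with Lagrange's identity `|a × b|² = |a|² |b|² - (a · b)²`. Lengths
enter as sums of squares because the norm of `Fin 3 → ℝ` is the maximum norm. -/
theorem abs_cross_dot_le {a b c : Fin 3 → ℝ} {A B C : ℝ} (hA : 0 ≤ A) (hB : 0 ≤ B) (hC : 0 ≤ C)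
    (ha : a 0 ^ 2 + a 1 ^ 2 + a 2 ^ 2 = A ^ 2) (hb : b 0 ^ 2 + b 1 ^ 2 + b 2 ^ 2 = B ^ 2)
    (hc : c 0 ^ 2 + c 1 ^ 2 + c 2 ^ 2 = C ^ 2) : |(a ⨯₃ b) ⬝ᵥ c| ≤ A * B * C := by
  rw [cross_dot_eq]
  refine abs_le_of_sq_le_sq ?_ (by positivity)
  set x := a 1 * b 2 - a 2 * b 1
  set y := a 2 * b 0 - a 0 * b 2
  set z := a 0 * b 1 - a 1 * b 0
  have h1 : (x * c 0 + y * c 1 + z * c 2) ^ 2 ≤ (x ^ 2 + y ^ 2 + z ^ 2) * C ^ 2 := by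
    rw [← hc]
    nlinarith [sq_nonneg (x * c 1 - y * c 0), sq_nonneg (x * c 2 - z * c 0),
      sq_nonneg (y * c 2 - z * c 1)]
  have h2 : x ^ 2 + y ^ 2 + z ^ 2 = A ^ 2 * B ^ 2 - (a 0 * b 0 + a 1 * b 1 + a 2 * b 2) ^ 2 := by
    rw [← ha, ← hb]; ring
  have h3 : x ^ 2 + y ^ 2 + z ^ 2 ≤ A ^ 2 * B ^ 2 := by
    rw [h2]; linarith [sq_nonneg (a 0 * b 0 + a 1 * b 1 + a 2 * b 2)]
  calc _ ≤ _ := h1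
    _ ≤ A ^ 2 * B ^ 2 * C ^ 2 := mul_le_mul_of_nonneg_right h3 (sq_nonneg _)
    _ = _ := by ring

theorem lorentzInt_smul_left (B : Pt d → EuclideanSpace ℝ (Fin 3)) (c : ℝ) (a : H0div Ω) (v : Vel Ω) :
    lorentzInt B (c • a) v = c * lorentzInt B a v := by
  unfold lorentzInt
  rw [← integral_const_mul]
  refine integral_congr_ae ?_
  rw [vec_smul]
  filter_upwards [Lp.coeFn_smul c (vec a)] with x hx
  rw [hx, Pi.smul_apply, lift3_smul, map_smul, LinearMap.smul_apply, smul_dotProduct, smul_eq_mul]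

theorem lorentzInt_smul_right (B : Pt d → EuclideanSpace ℝ (Fin 3)) (c : ℝ) (K : H0div Ω) (a : Vel Ω) :
    lorentzInt B K (c • a) = c * lorentzInt B K a := by
  unfold lorentzInt
  rw [← integral_const_mul]
  refine integral_congr_ae ?_
  filter_upwards [velAt_smul c a] with x hx
  rw [hx, lift3_smul, dotProduct_smul, smul_eq_mul]

namespace SobolevConstants

variable {lam1 lam2 CΩ : ℝ} (hd : d = 2 ∨ d = 3) (h : SobolevConstants Ω lam1 lam2 CΩ)
  {B : Pt d → EuclideanSpace ℝ (Fin 3)} (hB : MemLp B 3 (volume.restrict Ω))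

include hd h hB

/-- Hölder with exponents `2, 3, 6`, followed by the `L⁶` inequality for `v`. -/
theorem integrable_and_abs_lorentz_le (K : H0div Ω) (v : Vel Ω) :
    Integrable (fun x => (lift3 (vec K x) ⨯₃ WithLp.ofLp (B x)) ⬝ᵥ lift3 (velAt v x))
      (volume.restrict Ω) ∧
    |∫ x in Ω, (lift3 (vec K x) ⨯₃ WithLp.ofLp (B x)) ⬝ᵥ lift3 (velAt v x)| ≤
      lam1 * (eLpNorm B 3 (volume.restrict Ω)).toReal * ‖vec K‖ * velGradNorm v := by
  have hm : AEStronglyMeasurable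
      (fun x => (lift3 (vec K x) ⨯₃ WithLp.ofLp (B x)) ⬝ᵥ lift3 (velAt v x))
      (volume.restrict Ω) := by
    have c0 := fun i => (continuous_apply i).comp (continuous_lift3 (d := d))
    have c1 : ∀ i, AEStronglyMeasurable (fun x => lift3 (vec K x) i) (volume.restrict Ω) :=
      fun i => (c0 i).comp_aestronglyMeasurable (Lp.aestronglyMeasurable (vec K))
    have c2 : ∀ i, AEStronglyMeasurable (fun x => lift3 (velAt v x) i) (volume.restrict Ω) :=
      fun i => (c0 i).comp_aestronglyMeasurable (aestronglyMeasurable_velAt v)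
    have c3 : ∀ i, AEStronglyMeasurable (fun x => B x i) (volume.restrict Ω) :=
      fun i => (EuclideanSpace.proj i).continuous.comp_aestronglyMeasurable hB.1
    simp only [cross_dot_eq]
    have c4 : ∀ i j k, AEStronglyMeasurable
        (fun x => (lift3 (vec K x) i * B x j - lift3 (vec K x) j * B x i) * lift3 (velAt v x) k)
        (volume.restrict Ω) :=
      fun i j k => (((c1 i).mul (c3 j)).sub ((c1 j).mul (c3 i))).mul (c2 k)
    exact ((c4 1 2 0).add (c4 2 0 1)).add (c4 0 1 2)
  have hb : ∀ᵐ x ∂(volume.restrict Ω),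
      ‖(lift3 (vec K x) ⨯₃ WithLp.ofLp (B x)) ⬝ᵥ lift3 (velAt v x)‖ ≤
        ‖vec K x‖ * ‖B x‖ * ‖velAt v x‖ :=
    Eventually.of_forall fun x =>
      abs_cross_dot_le (norm_nonneg _) (norm_nonneg _) (norm_nonneg _) (sum_sq_lift3 hd (vec K x))
        (by rw [EuclideanSpace.real_norm_sq_eq, Fin.sum_univ_three])
        (sum_sq_lift3 hd (velAt v x))
  obtain ⟨h1, h2⟩ := integrable_and_abs_integral_le_mul_mul (p := 2) (q := 3) (r := 6)
    (s := 6 / 5) (Lp.memLp (vec K)) hB (h.memLp_velAt_six v) hm hb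
  refine ⟨h1, h2.trans ?_⟩
  have e := ENNReal.toReal_mono ENNReal.ofReal_ne_top (h.vel_L6 v)
  rw [ENNReal.toReal_ofReal (mul_nonneg h.lam1_pos.le (velGradNorm_nonneg v))] at e
  rw [← Lp.norm_def (vec K)]
  calc _ ≤ ‖vec K‖ * (eLpNorm B 3 (volume.restrict Ω)).toReal * (lam1 * velGradNorm v) := by
        gcongr
    _ = _ := by ring

theorem lorentzInt_add_left (a b : H0div Ω) (v : Vel Ω) :
    lorentzInt B (a + b) v = lorentzInt B a v + lorentzInt B b v := by
  unfold lorentzInt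
  rw [← integral_add (h.integrable_and_abs_lorentz_le hd hB a v).1
    (h.integrable_and_abs_lorentz_le hd hB b v).1]
  refine integral_congr_ae ?_
  rw [vec_add]
  filter_upwards [Lp.coeFn_add (vec a) (vec b)] with x hx
  rw [hx, Pi.add_apply, lift3_add, map_add, LinearMap.add_apply, add_dotProduct]

theorem lorentzInt_add_right (K : H0div Ω) (a b : Vel Ω) :
    lorentzInt B K (a + b) = lorentzInt B K a + lorentzInt B K b := by
  unfold lorentzInt
  rw [← integral_add (h.integrable_and_abs_lorentz_le hd hB K a).1
    (h.integrable_and_abs_lorentz_le hd hB K b).1]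
  refine integral_congr_ae ?_
  filter_upwards [velAt_add a b] with x hx
  rw [hx, lift3_add, dotProduct_add]

/-- The bilinear form `(K × B, v)`. -/
def lorentz : H0div Ω →ₗ[ℝ] Vel Ω →ₗ[ℝ] ℝ :=
  LinearMap.mk₂ ℝ (lorentzInt B) (h.lorentzInt_add_left hd hB)
    (lorentzInt_smul_left B) (h.lorentzInt_add_right hd hB)
    (lorentzInt_smul_right B)

theorem lorentz_apply (K : H0div Ω) (v : Vel Ω) : h.lorentz hd hB K v =
    ∫ x in Ω, (lift3 (vec K x) ⨯₃ WithLp.ofLp (B x)) ⬝ᵥ lift3 (velAt v x) := rfl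

theorem abs_lorentz_le (K : H0div Ω) (v : Vel Ω) : |h.lorentz hd hB K v| ≤
    lam1 * (eLpNorm B 3 (volume.restrict Ω)).toReal * ‖vec K‖ * velGradNorm v :=
  (h.integrable_and_abs_lorentz_le hd hB K v).2

end SobolevConstants

/-! ### The forms as linear maps -/

/-- The `i`-th component of a vector valued `L²` function. -/
def compL2 (i : Fin d) : L2V Ω →L[ℝ] L2S Ω :=
  (EuclideanSpace.proj (𝕜 := ℝ) i).compLpL 2 (volume.restrict Ω)

theorem coeFn_compL2 (i : Fin d) (ψ : L2V Ω) :
    compL2 i ψ =ᵐ[volume.restrict Ω] fun x => ψ x i :=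
  ContinuousLinearMap.coeFn_compLpL _ ψ

theorem norm_compL2_le (i : Fin d) (ψ : L2V Ω) : ‖compL2 i ψ‖ ≤ ‖ψ‖ := by
  refine Lp.norm_le_norm_of_ae_le ?_
  filter_upwards [coeFn_compL2 i ψ] with x hx
  rw [hx]
  exact PiLp.norm_apply_le (ψ x) i

/-- As an `L²` inner product the integral is visibly bilinear and bounded, with no integrability
left to check. -/
theorem integral_mul_velDiv (q : L2S Ω) (v : Vel Ω) :
    ∫ x in Ω, q x * velDiv v x = inner ℝ q (∑ i, compL2 i (grad (v i))) := by
  rw [L2.inner_def]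
  refine integral_congr_ae ?_
  have h : ∀ᵐ x ∂(volume.restrict Ω), ∀ i, compL2 i (grad (v i)) x = grad (v i) x i :=
    ae_all_iff.2 fun i => coeFn_compL2 i _
  filter_upwards [Lp.coeFn_finsetSum Finset.univ fun i => compL2 i (grad (v i)), h] with x hx h
  rw [hx]
  simp [velDiv, h, mul_comm]

theorem integral_mul_inner_velAt (q : L2S Ω) (a : Pt d) (v : Vel Ω) :
    ∫ x in Ω, q x * inner ℝ a (velAt v x) = inner ℝ q (∑ i, a i • fn (v i)) := by
  rw [L2.inner_def]
  refine integral_congr_ae ?_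
  have h : ∀ᵐ x ∂(volume.restrict Ω), ∀ i, (a i • fn (v i) : L2S Ω) x = a i * fn (v i) x :=
    ae_all_iff.2 fun i => Lp.coeFn_smul _ _
  filter_upwards [Lp.coeFn_finsetSum Finset.univ fun i => a i • fn (v i), h] with x hx h
  rw [hx]
  simp [velAt, h, PiLp.inner_apply, mul_comm]

/-- `e` as a bilinear map. -/
def eLin : H01 Ω →ₗ[ℝ] H01 Ω →ₗ[ℝ] ℝ :=
  LinearMap.mk₂ ℝ eForm (fun a b r => by simp [eForm, inner_add_left])
    (fun c a r => by simp [eForm, real_inner_smul_left])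
    (fun r a b => by simp [eForm, inner_add_right])
    (fun c r a => by simp [eForm, real_inner_smul_right])

theorem eForm_self (r : H01 Ω) : eForm r r = gradNorm r ^ 2 := real_inner_self_eq_norm_sq _

namespace SobolevConstants

variable {lam1 lam2 CΩ : ℝ} (h : SobolevConstants Ω lam1 lam2 CΩ)

/-- `H(η, ·, ·)` as a bilinear map. -/
def hLin (η : Vel Ω × H0div Ω) : H01 Ω →ₗ[ℝ] H01 Ω →ₗ[ℝ] ℝ :=
  (1 / 2 : ℝ) • h.transport η.1 - (1 / 2 : ℝ) • (h.transport η.1).flip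

theorem hLin_apply (η : Vel Ω × H0div Ω) (θ r : H01 Ω) : h.hLin η θ r = Hform η θ r := rfl

include h in
theorem Hform_sub (η η' : Vel Ω × H0div Ω) (θ r : H01 Ω) :
    Hform (η - η') θ r = Hform η θ r - Hform η' θ r := by
  simp only [← h.hLin_apply, hLin, Prod.fst_sub, map_sub, LinearMap.sub_apply,
    LinearMap.smul_apply, LinearMap.flip_apply, smul_eq_mul]
  ring

include h in
theorem abs_Hform_le (η : Vel Ω × H0div Ω) (θ r : H01 Ω) :
    |Hform η θ r| ≤ lam2 * norm1 η * gradNorm θ * gradNorm r := by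
  have h1 := h.abs_transport_le η.1 θ r
  have h2 := h.abs_transport_le η.1 r θ
  have h3 : lam2 * velGradNorm η.1 * ‖grad θ‖ * ‖grad r‖ ≤
      lam2 * norm1 η * ‖grad θ‖ * ‖grad r‖ := by
    have := h.lam2_pos
    have := velGradNorm_le_norm1 η
    gcongr
  change |1 / 2 * h.transport η.1 θ r - 1 / 2 * h.transport η.1 r θ| ≤
    lam2 * norm1 η * ‖grad θ‖ * ‖grad r‖
  rw [abs_le] at *
  constructor <;> linarith [h1.1, h1.2, h2.1, h2.2]

/-- `((w·∇)·, ·)` as a bilinear map. -/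
def convLin (w : Vel Ω) : Vel Ω →ₗ[ℝ] Vel Ω →ₗ[ℝ] ℝ :=
  ∑ i : Fin d, (h.transport w).compl₁₂ (LinearMap.proj i) (LinearMap.proj i)

theorem convLin_apply (w u v : Vel Ω) :
    h.convLin w u v = ∑ i, h.transport w (u i) (v i) := by
  simp [convLin, LinearMap.sum_apply]

theorem convLin_sub (w w' u v : Vel Ω) :
    h.convLin (w - w') u v = h.convLin w u v - h.convLin w' u v := by
  simp only [convLin_apply, map_sub, LinearMap.sub_apply, Finset.sum_sub_distrib]

theorem A1_eq (w η Φ : Vel Ω × H0div Ω) : A1 w η Φ =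
    1 / 2 * h.convLin w.1 η.1 Φ.1 - 1 / 2 * h.convLin w.1 Φ.1 η.1 := by
  have e : ∀ u v w, ∫ x in Ω, convect u v w x = h.convLin u v w := fun u v w =>
    (h.integral_convect u v w).trans (h.convLin_apply u v w).symm
  unfold A1
  rw [e w.1 η.1 Φ.1, e w.1 Φ.1 η.1]

/-- `A₁(w, ·, ·)` as a bilinear map. -/
def a1Lin (w : Vel Ω × H0div Ω) : Vel Ω × H0div Ω →ₗ[ℝ] Vel Ω × H0div Ω →ₗ[ℝ] ℝ :=
  ((1 / 2 : ℝ) • h.convLin w.1 - (1 / 2 : ℝ) • (h.convLin w.1).flip).compl₁₂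
    (LinearMap.fst ℝ _ _) (LinearMap.fst ℝ _ _)

theorem a1Lin_apply (w η Φ : Vel Ω × H0div Ω) : h.a1Lin w η Φ = A1 w η Φ := by
  rw [h.A1_eq]
  rfl

include h in
theorem A1_sub (w w' η Φ : Vel Ω × H0div Ω) : A1 (w - w') η Φ = A1 w η Φ - A1 w' η Φ := by
  have e1 : h.convLin (w - w').1 η.1 Φ.1 = _ := h.convLin_sub w.1 w'.1 η.1 Φ.1
  have e2 : h.convLin (w - w').1 Φ.1 η.1 = _ := h.convLin_sub w.1 w'.1 Φ.1 η.1
  linear_combination h.A1_eq (w - w') η Φ - h.A1_eq w η Φ + h.A1_eq w' η Φ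
    + (1 / 2) * e1 - (1 / 2) * e2

/-- Cauchy–Schwarz over the components avoids a factor `d`, so that exactly `lam2` enters `σ`. -/
theorem abs_convLin_le (u v w : Vel Ω) : |h.convLin u v w| ≤
    lam2 * velGradNorm u * velGradNorm v * velGradNorm w := by
  rw [h.convLin_apply]
  have h0 : 0 ≤ lam2 * velGradNorm u := mul_nonneg h.lam2_pos.le (velGradNorm_nonneg u)
  calc _ ≤ ∑ i, |h.transport u (v i) (w i)| := Finset.abs_sum_le_sum_abs _ _
    _ ≤ ∑ i, lam2 * velGradNorm u * (‖grad (v i)‖ * ‖grad (w i)‖) :=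
        Finset.sum_le_sum fun i _ => (h.abs_transport_le u (v i) (w i)).trans_eq (by ring)
    _ = lam2 * velGradNorm u * ∑ i, ‖grad (v i)‖ * ‖grad (w i)‖ := by rw [Finset.mul_sum]
    _ ≤ lam2 * velGradNorm u * (velGradNorm v * velGradNorm w) :=
        mul_le_mul_of_nonneg_left (sum_norm_grad_mul_le v w) h0
    _ = _ := by ring

include h in
theorem abs_A1_le (w η Φ : Vel Ω × H0div Ω) :
    |A1 w η Φ| ≤ lam2 * norm1 w * norm1 η * norm1 Φ := by
  have h1 := h.abs_convLin_le w.1 η.1 Φ.1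
  have h2 := h.abs_convLin_le w.1 Φ.1 η.1
  have h3 : lam2 * velGradNorm w.1 * velGradNorm η.1 * velGradNorm Φ.1 ≤
      lam2 * norm1 w * norm1 η * norm1 Φ := by
    have := h.lam2_pos
    have := velGradNorm_le_norm1 w
    have := velGradNorm_le_norm1 η
    have := velGradNorm_le_norm1 Φ
    have := velGradNorm_nonneg w.1
    have := velGradNorm_nonneg η.1
    have := velGradNorm_nonneg Φ.1
    have := norm1_nonneg w
    have := norm1_nonneg η
    gcongr
  rw [h.A1_eq]
  rw [abs_le] at *
  constructor <;> linarith [h1.1, h1.2, h2.1, h2.2]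

include h in
-- Elements of `H01` are pairs (function, gradient), so the Poincaré inequality is what makes the
-- first entry vanish.
theorem eq_zero_of_gradNorm {r : H01 Ω} (hr : gradNorm r = 0) : r = 0 := by
  have h1 : grad r = 0 := norm_eq_zero.1 hr
  have h2 : fn r = 0 := by
    have := h.norm_fn_le r
    rw [h1, norm_zero, mul_zero] at this
    exact norm_le_zero_iff.1 this
  exact Subtype.ext (Prod.ext h2 h1)

include h in
theorem eq_zero_of_velGradNorm {v : Vel Ω} (hv : velGradNorm v = 0) : v = 0 := by
  funext i
  refine h.eq_zero_of_gradNorm (le_antisymm ?_ (gradNorm_nonneg _))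
  exact (norm_grad_le_velGradNorm v i).trans hv.le

theorem eq_zero_of_divNorm {K : H0div Ω} (hK : divNorm K = 0) : K = 0 :=
  Subtype.ext (Prod.ext (norm_le_zero_iff.1 ((norm_vec_le K).trans hK.le))
    (norm_le_zero_iff.1 ((norm_wdiv_le K).trans hK.le)))

include h in
theorem eq_zero_of_norm1 {Φ : Vel Ω × H0div Ω} (hΦ : norm1 Φ = 0) : Φ = 0 :=
  Prod.ext
    (h.eq_zero_of_velGradNorm
      (le_antisymm ((velGradNorm_le_norm1 Φ).trans hΦ.le) (velGradNorm_nonneg _)))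
    (eq_zero_of_divNorm (le_antisymm ((divNorm_le_norm1 Φ).trans hΦ.le) (divNorm_nonneg _)))

include h in
theorem norm_H01_le (r : H01 Ω) : ‖r‖ ≤ (CΩ + 1) * gradNorm r := by
  have h1 := h.norm_fn_le r
  have h2 := h.CΩ_pos
  have h3 := gradNorm_nonneg r
  change max ‖fn r‖ ‖grad r‖ ≤ _
  rw [gradNorm] at *
  exact max_le (by nlinarith) (by nlinarith)

include h in
theorem norm_Vel_le (v : Vel Ω) : ‖v‖ ≤ (CΩ + 1) * velGradNorm v := by
  have h2 := h.CΩ_pos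
  refine (pi_norm_le_iff_of_nonneg (mul_nonneg (by positivity) (velGradNorm_nonneg v))).2
    fun i => (h.norm_H01_le (v i)).trans ?_
  exact mul_le_mul_of_nonneg_left (norm_grad_le_velGradNorm v i) (by positivity)

include h in
-- The ambient norm is a maximum of norms. This comparison turns estimates in `norm1` into
-- convergence in the ambient space.
theorem norm_le_norm1 (Φ : Vel Ω × H0div Ω) : ‖Φ‖ ≤ (CΩ + 1) * norm1 Φ := by
  have h2 := h.CΩ_pos
  have h3 := norm1_nonneg Φ
  refine max_le ((h.norm_Vel_le Φ.1).trans ?_) ?_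
  · exact mul_le_mul_of_nonneg_left (velGradNorm_le_norm1 Φ) (by positivity)
  · refine le_trans ?_ (show norm1 Φ ≤ _ by nlinarith)
    exact max_le ((norm_vec_le Φ.2).trans (divNorm_le_norm1 Φ))
      ((norm_wdiv_le Φ.2).trans (divNorm_le_norm1 Φ))

end SobolevConstants

theorem continuous_norm1 : Continuous (norm1 : Vel Ω × H0div Ω → ℝ) := by
  have h1 : Continuous fun Φ : Vel Ω × H0div Ω => ‖vec Φ.2‖ :=
    (continuous_fst.comp (continuous_subtype_val.comp continuous_snd)).norm
  have h2 : Continuous fun Φ : Vel Ω × H0div Ω => ‖wdiv Φ.2‖ :=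
    (continuous_snd.comp (continuous_subtype_val.comp continuous_snd)).norm
  have h3 : ∀ i, Continuous fun Φ : Vel Ω × H0div Ω => ‖grad (Φ.1 i)‖ := fun i =>
    (continuous_snd.comp
      (continuous_subtype_val.comp ((continuous_apply i).comp continuous_fst))).norm
  have h4 : Continuous fun Φ : Vel Ω × H0div Ω => velGradNorm Φ.1 :=
    (continuous_finsetSum _ fun i _ => (h3 i).pow 2).sqrt
  have h5 : Continuous fun Φ : Vel Ω × H0div Ω => divNorm Φ.2 :=
    ((h1.pow 2).add (h2.pow 2)).sqrt
  exact ((h4.pow 2).add (h5.pow 2)).sqrt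

/-! ### Supremum norms of functionals -/

/-- The bound `hC` makes the set of quotients bounded above; otherwise the real `sSup` would take
its default value `0`. -/
theorem le_sSup_div_mul {E : Type*} [Zero E] {f N : E → ℝ} (hN : ∀ v, 0 ≤ N v)
    (hN0 : ∀ v, N v = 0 ↔ v = 0) (hf0 : f 0 = 0) {C : ℝ} (hC : ∀ v, f v ≤ C * N v) (v : E) :
    f v ≤ sSup {t | ∃ v : E, v ≠ 0 ∧ t = f v / N v} * N v := by
  by_cases hv : v = 0
  · rw [hv, hf0, (hN0 0).2 rfl, mul_zero]
  · have hNv : 0 < N v := lt_of_le_of_ne (hN v) fun h => hv ((hN0 v).1 h.symm)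
    rw [← div_le_iff₀ hNv]
    refine le_csSup ⟨C, ?_⟩ ⟨v, hv, rfl⟩
    rintro _ ⟨w, hw, rfl⟩
    have hNw : 0 < N w := lt_of_le_of_ne (hN w) fun h => hw ((hN0 w).1 h.symm)
    rw [div_le_iff₀ hNw]
    exact hC w

theorem norm1_zero : norm1 (0 : Vel Ω × H0div Ω) = 0 := by
  have h1 : grad (0 : H01 Ω) = 0 := rfl
  have h2 : vec (0 : H0div Ω) = 0 := rfl
  have h3 : wdiv (0 : H0div Ω) = 0 := rfl
  simp [norm1, velGradNorm, divNorm, h1, h2, h3]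

theorem velGradNorm_zero : velGradNorm (0 : Vel Ω) = 0 :=
  le_antisymm ((velGradNorm_le_norm1 (0 : Vel Ω × H0div Ω)).trans_eq norm1_zero)
    (velGradNorm_nonneg _)

theorem gradNorm_zero : gradNorm (0 : H01 Ω) = 0 := norm_zero

namespace Data

variable (D : Data Ω)

/-! ### Forms depending on the data -/

/-- `L` as a linear map. -/
def lLin : Vel Ω × H0div Ω →ₗ[ℝ] ℝ where
  toFun := D.L
  map_add' a b := by simp [L, inner_add_right]; ring
  map_smul' c a := by simp [L, real_inner_smul_right]; ring

/-- `Q` as a bilinear map. -/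
def qLin : H01 Ω →ₗ[ℝ] Vel Ω × H0div Ω →ₗ[ℝ] ℝ :=
  LinearMap.mk₂ ℝ D.Q
    (fun a b r => by
      simp only [Q, integral_mul_inner_velAt, fn_add, inner_add_left]; ring)
    (fun c a r => by
      simp only [Q, integral_mul_inner_velAt, fn_smul, real_inner_smul_left, smul_eq_mul]; ring)
    (fun r a b => by
      simp only [Q, integral_mul_inner_velAt, Prod.fst_add, Pi.add_apply, fn_add, smul_add,
        Finset.sum_add_distrib, inner_add_right]; ring)
    (fun c r a => by
      simp only [Q, integral_mul_inner_velAt, Prod.smul_fst, Pi.smul_apply, fn_smul,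
        smul_comm _ c, ← Finset.smul_sum, real_inner_smul_right, smul_eq_mul]; ring)

theorem qLin_apply (θ : H01 Ω) (Φ : Vel Ω × H0div Ω) : D.qLin θ Φ = D.Q θ Φ := rfl

theorem bS_eq (q : L20 Ω) (v : Vel Ω) :
    D.bS q v = -D.Pr * inner ℝ (q : L2S Ω) (∑ i, compL2 i (grad (v i))) := by
  rw [bS, integral_mul_velDiv]

/-- `b_s` as a bilinear map. -/
def bSLin : L20 Ω →ₗ[ℝ] Vel Ω →ₗ[ℝ] ℝ :=
  LinearMap.mk₂ ℝ D.bS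
    (fun a b v => by
      simp only [bS_eq, Submodule.coe_add, inner_add_left]; ring)
    (fun c a v => by
      simp only [bS_eq, Submodule.coe_smul, real_inner_smul_left, smul_eq_mul]; ring)
    (fun q a b => by
      simp only [bS_eq, Pi.add_apply, grad_add, map_add, Finset.sum_add_distrib,
        inner_add_right]; ring)
    (fun c q a => by
      simp only [bS_eq, Pi.smul_apply, grad_smul, map_smul, ← Finset.smul_sum,
        real_inner_smul_right, smul_eq_mul]; ring)

/-- `b_m` as a bilinear map. -/
def bMLin : L20 Ω →ₗ[ℝ] H0div Ω →ₗ[ℝ] ℝ :=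
  LinearMap.mk₂ ℝ D.bM
    (fun a b v => by
      simp only [bM, Submodule.coe_add, inner_add_left]; ring)
    (fun c a v => by
      simp only [bM, Submodule.coe_smul, real_inner_smul_left, smul_eq_mul]; ring)
    (fun q a b => by simp only [bM, wdiv_add, inner_add_right]; ring)
    (fun c q a => by simp only [bM, wdiv_smul, real_inner_smul_right, smul_eq_mul]; ring)

theorem bSLin_apply (q : L20 Ω) (v : Vel Ω) : D.bSLin q v = D.bS q v := rfl

/-- `B` as a bilinear map. -/
def bLin : L20 Ω × L20 Ω →ₗ[ℝ] Vel Ω × H0div Ω →ₗ[ℝ] ℝ :=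
  D.bSLin.compl₁₂ (LinearMap.fst ℝ _ _) (LinearMap.fst ℝ _ _) +
    D.bMLin.compl₁₂ (LinearMap.snd ℝ _ _) (LinearMap.snd ℝ _ _)

theorem bLin_apply (χ : L20 Ω × L20 Ω) (Φ : Vel Ω × H0div Ω) : D.bLin χ Φ = D.Bform χ Φ := rfl

theorem abs_bS_le (q : L20 Ω) (v : Vel Ω) : |D.bS q v| ≤ D.Pr * d * ‖q‖ * velGradNorm v := by
  have h1 : ‖∑ i, compL2 i (grad (v i))‖ ≤ d * velGradNorm v := by
    refine (norm_sum_le _ _).trans ((Finset.sum_le_sum fun i _ =>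
      (norm_compL2_le i _).trans (norm_grad_le_velGradNorm v i)).trans_eq ?_)
    simp
  rw [bS_eq, abs_mul, abs_neg, abs_of_pos D.Pr_pos]
  calc _ ≤ D.Pr * (‖q‖ * (d * velGradNorm v)) := by
        refine mul_le_mul_of_nonneg_left ?_ D.Pr_pos.le
        exact (abs_real_inner_le_norm _ _).trans (mul_le_mul_of_nonneg_left h1 (norm_nonneg _))
    _ = _ := by ring

theorem abs_bM_le (ψ : L20 Ω) (K : H0div Ω) : |D.bM ψ K| ≤ D.κ * ‖ψ‖ * divNorm K := by
  rw [bM, abs_mul, abs_neg, abs_of_pos D.κ_pos, mul_assoc]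
  refine mul_le_mul_of_nonneg_left ?_ D.κ_pos.le
  exact (abs_real_inner_le_norm _ _).trans
    (mul_le_mul_of_nonneg_left (norm_wdiv_le K) (norm_nonneg _))

theorem Bform_le (χ : L20 Ω × L20 Ω) (Φ : Vel Ω × H0div Ω) :
    D.Bform χ Φ ≤ (D.Pr * d * ‖χ.1‖ + D.κ * ‖χ.2‖) * norm1 Φ := by
  have h1 := (le_abs_self _).trans (D.abs_bS_le χ.1 Φ.1)
  have h2 := (le_abs_self _).trans (D.abs_bM_le χ.2 Φ.2)
  have h3 := mul_le_mul_of_nonneg_left (velGradNorm_le_norm1 Φ)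
    (show 0 ≤ D.Pr * d * ‖χ.1‖ by have := D.Pr_pos; positivity)
  have h4 := mul_le_mul_of_nonneg_left (divNorm_le_norm1 Φ)
    (show 0 ≤ D.κ * ‖χ.2‖ by have := D.κ_pos; positivity)
  rw [Bform, add_mul]
  linarith

theorem Cmin_pos : 0 < D.Cmin := lt_min D.Pr_pos D.κ_pos

theorem Lstar_nonneg : 0 ≤ D.Lstar := Real.sqrt_nonneg _

theorem lamQ_nonneg (CΩ : ℝ) : 0 ≤ D.lamQ CΩ :=
  mul_nonneg (mul_nonneg D.Pr_pos.le D.Ra_nonneg) (sq_nonneg _)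

variable {lam1 lam2 CΩ : ℝ} (h : SobolevConstants Ω lam1 lam2 CΩ)

section Bounds
include h

theorem φ_le (r : H01 Ω) : D.φ r ≤ D.lamPsi * gradNorm r := by
  refine le_sSup_div_mul (f := fun r => D.φ r) (N := gradNorm) gradNorm_nonneg
    (fun r => ⟨h.eq_zero_of_gradNorm, fun h => by rw [h, gradNorm_zero]⟩) (map_zero _)
    (C := ‖D.φ‖ * (CΩ + 1)) (fun r => ?_) r
  rw [mul_assoc]
  exact ((le_abs_self _).trans (D.φ.le_opNorm r)).trans
    (mul_le_mul_of_nonneg_left (h.norm_H01_le r) (norm_nonneg _))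

theorem f_le (v : Vel Ω) : D.f v ≤ D.fNorm * velGradNorm v := by
  refine le_sSup_div_mul (f := fun v => D.f v) (N := velGradNorm) velGradNorm_nonneg
    (fun v => ⟨h.eq_zero_of_velGradNorm, fun h => by rw [h, velGradNorm_zero]⟩) (map_zero _)
    (C := ‖D.f‖ * (CΩ + 1)) (fun v => ?_) v
  rw [mul_assoc]
  exact ((le_abs_self _).trans (D.f.le_opNorm v)).trans
    (mul_le_mul_of_nonneg_left (h.norm_Vel_le v) (norm_nonneg _))

/-- If some `r ≠ 0` exists, the bound for `r` and `-r` forces the sign. Otherwise the supremum is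
over the empty set and equals `0`. -/
theorem lamPsi_nonneg : 0 ≤ D.lamPsi := by
  by_cases hr : ∃ r : H01 Ω, r ≠ 0
  · obtain ⟨r, hr⟩ := hr
    have h1 := D.φ_le h r
    have h2 := D.φ_le h (-r)
    have h3 : gradNorm (-r) = gradNorm r := norm_neg (grad r)
    have h4 : 0 < gradNorm r :=
      lt_of_le_of_ne (gradNorm_nonneg r) fun h0 => hr (h.eq_zero_of_gradNorm h0.symm)
    rw [map_neg, h3] at h2
    by_contra! h5
    nlinarith
  · push Not at hr
    refine Real.sSup_nonneg ?_
    rintro _ ⟨r, h0, -⟩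
    exact absurd (hr r) h0

theorem L_le (Φ : Vel Ω × H0div Ω) : D.L Φ ≤ D.Lstar * norm1 Φ := by
  have h1 := D.f_le h Φ.1
  have h2 : D.κ * inner ℝ D.g (vec Φ.2) ≤ D.κ * ‖D.g‖ * divNorm Φ.2 := by
    rw [mul_assoc]
    refine mul_le_mul_of_nonneg_left ?_ D.κ_pos.le
    exact (real_inner_le_norm _ _).trans
      (mul_le_mul_of_nonneg_left (norm_vec_le _) (norm_nonneg _))
  have h3 : D.fNorm * velGradNorm Φ.1 + D.κ * ‖D.g‖ * divNorm Φ.2 ≤ D.Lstar * norm1 Φ := by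
    rw [Lstar, norm1, ← Real.sqrt_mul (by positivity)]
    refine Real.le_sqrt_of_sq_le ?_
    -- Cauchy–Schwarz in `ℝ²`, in the form of Lagrange's identity.
    nlinarith [sq_nonneg (D.fNorm * divNorm Φ.2 - D.κ * ‖D.g‖ * velGradNorm Φ.1)]
  rw [L]
  linarith

/-- Poincaré is used once for `θ` and once for the velocity, whence `CΩ ^ 2`; the direction has
length one and costs nothing. -/
theorem abs_Q_le (θ : H01 Ω) (Φ : Vel Ω × H0div Ω) :
    |D.Q θ Φ| ≤ D.lamQ CΩ * gradNorm θ * norm1 Φ := by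
  have hc := h.CΩ_pos
  have h1 : ‖∑ i, D.ivec i • fn (Φ.1 i)‖ ≤ CΩ * velGradNorm Φ.1 := by
    calc ‖∑ i, D.ivec i • fn (Φ.1 i)‖ ≤ ∑ i, ‖D.ivec i‖ * (CΩ * ‖grad (Φ.1 i)‖) := by
          refine (norm_sum_le _ _).trans (Finset.sum_le_sum fun i _ => ?_)
          rw [norm_smul]
          exact mul_le_mul_of_nonneg_left (h.norm_fn_le _) (norm_nonneg _)
      _ = CΩ * ∑ i, ‖D.ivec i‖ * ‖grad (Φ.1 i)‖ := by
          rw [Finset.mul_sum]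
          exact Finset.sum_congr rfl fun i _ => by ring
      _ ≤ CΩ * (√(∑ i, ‖D.ivec i‖ ^ 2) * velGradNorm Φ.1) :=
          mul_le_mul_of_nonneg_left (Real.sum_mul_le_sqrt_mul_sqrt _ _ _) hc.le
      _ = _ := by rw [← EuclideanSpace.norm_eq, D.norm_ivec, one_mul]
  have h2 : 0 ≤ D.Pr * D.Ra := mul_nonneg D.Pr_pos.le D.Ra_nonneg
  have h3 := gradNorm_nonneg θ
  rw [Q, integral_mul_inner_velAt, abs_mul, abs_neg, abs_of_nonneg h2]
  calc _ ≤ D.Pr * D.Ra * ((CΩ * gradNorm θ) * (CΩ * norm1 Φ)) := by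
        refine mul_le_mul_of_nonneg_left ((abs_real_inner_le_norm _ _).trans ?_) h2
        exact mul_le_mul (h.norm_fn_le θ)
          (h1.trans (mul_le_mul_of_nonneg_left (velGradNorm_le_norm1 Φ) hc.le))
          (norm_nonneg _) (by positivity)
    _ = _ := by rw [lamQ]; ring

end Bounds

variable (hd : d = 2 ∨ d = 3)

theorem A0_eq (η Φ : Vel Ω × H0div Ω) : D.A0 η Φ = D.aS η.1 Φ.1 + D.aM η.2 Φ.2
    - D.κ * h.lorentz hd D.B_mem η.2 Φ.1 + D.κ * h.lorentz hd D.B_mem Φ.2 η.1 := by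
  simp only [A0, dForm, SobolevConstants.lorentz_apply]
  ring

/-- `a_s` as a bilinear map. -/
def aSLin : Vel Ω →ₗ[ℝ] Vel Ω →ₗ[ℝ] ℝ :=
  LinearMap.mk₂ ℝ D.aS
    (fun a b c => by simp [aS, inner_add_left, Finset.sum_add_distrib, mul_add])
    (fun c a b => by simp [aS, real_inner_smul_left, ← Finset.mul_sum, mul_left_comm])
    (fun a b c => by simp [aS, inner_add_right, Finset.sum_add_distrib, mul_add])
    (fun c a b => by simp [aS, real_inner_smul_right, ← Finset.mul_sum, mul_left_comm])

/-- `a_m` as a bilinear map. -/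
def aMLin : H0div Ω →ₗ[ℝ] H0div Ω →ₗ[ℝ] ℝ :=
  LinearMap.mk₂ ℝ D.aM
    (fun a b c => by simp [aM, inner_add_left, mul_add])
    (fun c a b => by simp [aM, real_inner_smul_left, mul_left_comm])
    (fun a b c => by simp [aM, inner_add_right, mul_add])
    (fun c a b => by simp [aM, real_inner_smul_right, mul_left_comm])

/-- `A₀` as a bilinear map. -/
def a0Lin : Vel Ω × H0div Ω →ₗ[ℝ] Vel Ω × H0div Ω →ₗ[ℝ] ℝ :=
  D.aSLin.compl₁₂ (LinearMap.fst ℝ _ _) (LinearMap.fst ℝ _ _)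
    + D.aMLin.compl₁₂ (LinearMap.snd ℝ _ _) (LinearMap.snd ℝ _ _)
    - D.κ • (h.lorentz hd D.B_mem).compl₁₂ (LinearMap.snd ℝ _ _) (LinearMap.fst ℝ _ _)
    + D.κ • ((h.lorentz hd D.B_mem).compl₁₂ (LinearMap.snd ℝ _ _) (LinearMap.fst ℝ _ _)).flip

theorem a0Lin_apply (η Φ : Vel Ω × H0div Ω) : D.a0Lin h hd η Φ = D.A0 η Φ := by
  rw [D.A0_eq h hd]
  rfl

/-- The two Lorentz terms cancel on the diagonal. -/
theorem A0_self (η : Vel Ω × H0div Ω) :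
    D.A0 η η = D.Pr * velGradNorm η.1 ^ 2 + D.κ * ‖vec η.2‖ ^ 2 := by
  simp only [A0, aS, aM, sq_velGradNorm, real_inner_self_eq_norm_sq]
  ring

/-- `A0` does not control the divergence of the magnetic field, which is part of `norm1`; hence the
hypothesis `hη`. -/
theorem Cmin_mul_le_A0_self {η : Vel Ω × H0div Ω} (hη : wdiv η.2 = 0) :
    D.Cmin * norm1 η ^ 2 ≤ D.A0 η η := by
  rw [A0_self, sq_norm1, sq_divNorm, hη, norm_zero]
  have h1 := mul_le_mul_of_nonneg_right (min_le_left D.Pr D.κ) (sq_nonneg (velGradNorm η.1))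
  have h2 := mul_le_mul_of_nonneg_right (min_le_right D.Pr D.κ) (sq_nonneg ‖vec η.2‖)
  rw [Cmin]
  linarith

set_option maxHeartbeats 800000 in
include h hd in
theorem abs_A0_le (η Φ : Vel Ω × H0div Ω) : |D.A0 η Φ| ≤ D.Cmax lam1 * norm1 η * norm1 Φ := by
  have hP := D.Pr_pos
  have hκ := D.κ_pos
  have l1 := h.lam1_pos
  have n1 := velGradNorm_nonneg η.1
  have n2 := velGradNorm_nonneg Φ.1
  set b := (eLpNorm D.B 3 (volume.restrict Ω)).toReal with hb
  have b0 : 0 ≤ b := ENNReal.toReal_nonneg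
  set m := max (max D.Pr D.κ) (D.κ * lam1 * b) with hm
  have m1 : D.Pr ≤ m := (le_max_left _ _).trans (le_max_left _ _)
  have m2 : D.κ ≤ m := (le_max_right _ _).trans (le_max_left _ _)
  have m3 : D.κ * lam1 * b ≤ m := le_max_right _ _
  have hm0 : 0 ≤ m := hP.le.trans m1
  have h1 : |D.aS η.1 Φ.1| ≤ m * (velGradNorm η.1 * velGradNorm Φ.1) := by
    rw [aS, abs_mul, abs_of_pos hP]
    refine mul_le_mul m1 ?_ (abs_nonneg _) hm0
    refine (Finset.abs_sum_le_sum_abs _ _).trans (le_trans ?_ (sum_norm_grad_mul_le _ _))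
    exact Finset.sum_le_sum fun i _ => abs_real_inner_le_norm _ _
  have h2 : |D.aM η.2 Φ.2| ≤ m * (‖vec η.2‖ * ‖vec Φ.2‖) := by
    rw [aM, abs_mul, abs_of_pos hκ]
    exact mul_le_mul m2 (abs_real_inner_le_norm _ _) (abs_nonneg _) hm0
  have h3 : ∀ (K : H0div Ω) (v : Vel Ω), |D.κ * h.lorentz hd D.B_mem K v| ≤
      m * (‖vec K‖ * velGradNorm v) := by
    intro K v
    have n3 := velGradNorm_nonneg v
    rw [abs_mul, abs_of_pos hκ]
    calc _ ≤ D.κ * (lam1 * b * ‖vec K‖ * velGradNorm v) :=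
          mul_le_mul_of_nonneg_left (h.abs_lorentz_le hd D.B_mem K v) hκ.le
      _ = D.κ * lam1 * b * (‖vec K‖ * velGradNorm v) := by ring
      _ ≤ _ := mul_le_mul_of_nonneg_right m3 (by positivity)
  -- The four terms of `A0` are dominated by `m` times a product of two sums. Each sum costs `√2`,
  -- which gives the factor 2 in `Cmax`.
  have h4 : ∀ Ψ : Vel Ω × H0div Ω, (velGradNorm Ψ.1 + ‖vec Ψ.2‖) ≤ √2 * norm1 Ψ := by
    intro Ψ
    rw [norm1, ← Real.sqrt_mul zero_le_two, sq_divNorm]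
    refine Real.le_sqrt_of_sq_le ?_
    nlinarith [sq_nonneg (velGradNorm Ψ.1 - ‖vec Ψ.2‖), sq_nonneg ‖wdiv Ψ.2‖]
  have h5 : (velGradNorm η.1 + ‖vec η.2‖) * (velGradNorm Φ.1 + ‖vec Φ.2‖) ≤
      2 * (norm1 η * norm1 Φ) := by
    refine (mul_le_mul (h4 η) (h4 Φ) (by positivity)
      (mul_nonneg (Real.sqrt_nonneg _) (norm1_nonneg _))).trans_eq ?_
    rw [mul_mul_mul_comm, Real.mul_self_sqrt zero_le_two]
  have h6 := mul_le_mul_of_nonneg_left h5 hm0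
  have h7 := h3 η.2 Φ.1
  have h8 := h3 Φ.2 η.1
  have hC : D.Cmax lam1 = 2 * m := rfl
  have h9 : m * (velGradNorm η.1 * velGradNorm Φ.1) + m * (‖vec η.2‖ * ‖vec Φ.2‖)
      + m * (‖vec η.2‖ * velGradNorm Φ.1) + m * (‖vec Φ.2‖ * velGradNorm η.1) ≤
      2 * m * norm1 η * norm1 Φ := by
    refine (le_of_eq ?_).trans (h6.trans_eq ?_) <;> ring
  rw [D.A0_eq h hd, hC]
  obtain ⟨a1, a2⟩ := abs_le.1 h1
  obtain ⟨b1, b2⟩ := abs_le.1 h2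
  obtain ⟨c1, c2⟩ := abs_le.1 h7
  obtain ⟨d1, d2⟩ := abs_le.1 h8
  exact abs_le.2 ⟨by linarith, by linarith⟩

end Data

/-! ### The abstract Oseen iteration. -/

/-- The abstract form of a linearized coupled saddle point problem: bilinear forms, discrete
spaces `U`, `W`, `T`, (semi)norms `N`, `NZ`, and the bounds of the forms. -/
structure OseenSystem (H P Z : Type*) [NormedAddCommGroup H] [NormedSpace ℝ H]
    [AddCommGroup P] [Module ℝ P] [AddCommGroup Z] [Module ℝ Z] where
  A0 : H →ₗ[ℝ] H →ₗ[ℝ] ℝ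
  A1 : H → H →ₗ[ℝ] H →ₗ[ℝ] ℝ
  B : P →ₗ[ℝ] H →ₗ[ℝ] ℝ
  Q : Z →ₗ[ℝ] H →ₗ[ℝ] ℝ
  e : Z →ₗ[ℝ] Z →ₗ[ℝ] ℝ
  Hf : H → Z →ₗ[ℝ] Z →ₗ[ℝ] ℝ
  L : H →ₗ[ℝ] ℝ
  φ : Z →ₗ[ℝ] ℝ
  U : Submodule ℝ H
  W : Submodule ℝ P
  T : Submodule ℝ Z
  finU : FiniteDimensional ℝ U
  finW : FiniteDimensional ℝ W
  finT : FiniteDimensional ℝ T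
  N : H → ℝ
  NZ : Z → ℝ
  /-- coercivity constant of `A0` -/
  c : ℝ
  /-- continuity constant of `A0` -/
  CM : ℝ
  /-- continuity constant of `A1` and `Hf` -/
  l2 : ℝ
  /-- continuity constant of `Q` -/
  lq : ℝ
  /-- norm of `φ` -/
  lp : ℝ
  /-- norm of `L` -/
  ls : ℝ
  /-- constant of `‖·‖ ≤ K N` -/
  K : ℝ
  c_pos : 0 < c
  CM_nonneg : 0 ≤ CM
  l2_pos : 0 < l2
  lq_nonneg : 0 ≤ lq
  lp_nonneg : 0 ≤ lp
  ls_nonneg : 0 ≤ ls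
  N_nonneg : ∀ η, 0 ≤ N η
  NZ_nonneg : ∀ r, 0 ≤ NZ r
  N_zero : N 0 = 0
  norm_le : ∀ η, ‖η‖ ≤ K * N η
  N_continuous : Continuous N
  NZ_eq_zero : ∀ r, NZ r = 0 → r = 0
  A1_sub : ∀ w w' η Φ, A1 (w - w') η Φ = A1 w η Φ - A1 w' η Φ
  Hf_sub : ∀ w w' θ r, Hf (w - w') θ r = Hf w θ r - Hf w' θ r
  A1_self : ∀ w η, A1 w η η = 0
  Hf_self : ∀ w r, Hf w r r = 0
  e_self : ∀ r, e r r = NZ r ^ 2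
  coercive : ∀ η ∈ U, (∀ χ ∈ W, B χ η = 0) → c * N η ^ 2 ≤ A0 η η
  B_injective : ∀ χ ∈ W, (∀ Φ ∈ U, B χ Φ = 0) → χ = 0
  A0_le : ∀ η Φ, |A0 η Φ| ≤ CM * N η * N Φ
  A1_le : ∀ w η Φ, |A1 w η Φ| ≤ l2 * N w * N η * N Φ
  Hf_le : ∀ w θ r, |Hf w θ r| ≤ l2 * N w * NZ θ * NZ r
  Q_le : ∀ θ Φ, |Q θ Φ| ≤ lq * NZ θ * N Φ
  L_le : ∀ Φ, L Φ ≤ ls * N Φ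
  φ_le : ∀ r, φ r ≤ lp * NZ r

namespace OseenSystem

variable {H P Z : Type*} [NormedAddCommGroup H] [NormedSpace ℝ H]
    [AddCommGroup P] [Module ℝ P] [AddCommGroup Z] [Module ℝ Z] (O : OseenSystem H P Z)

/-- `x = (η, ξ, θ)` solves the problem linearized at `w`. -/
def Step (w : H) (x : H × P × Z) : Prop :=
  (x.1 ∈ O.U ∧ x.2.1 ∈ O.W ∧ x.2.2 ∈ O.T) ∧
  (∀ Φ ∈ O.U, O.A0 x.1 Φ + O.A1 w x.1 Φ + O.B x.2.1 Φ + O.Q x.2.2 Φ = O.L Φ) ∧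
  (∀ χ ∈ O.W, O.B χ x.1 = 0) ∧
  (∀ r ∈ O.T, O.e x.2.2 r + O.Hf w x.2.2 r = O.φ r)

/-- The a priori bound of the solutions. -/
def M : ℝ := (O.ls + O.lp * O.lq) / O.c

/-- The contraction factor. -/
def σ : ℝ := O.l2 * O.ls / O.c ^ 2 + O.l2 * O.lq * O.lp / O.c ^ 2 + O.l2 * O.lq * O.lp / O.c
  + O.l2 * O.ls / O.c

variable {O}

theorem M_nonneg : 0 ≤ O.M := by
  have := O.c_pos
  have := O.ls_nonneg
  have := O.lp_nonneg
  have := O.lq_nonneg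
  unfold M
  positivity

/-- The four summands of `σ` collapse to `(1 + 1/c) * l2 * M`; the comparisons that follow are read
off from this form. -/
theorem σ_eq : O.σ = O.l2 * O.M / O.c + O.l2 * O.M := by
  have := O.c_pos.ne'
  unfold σ M
  field_simp
  ring

theorem σ_nonneg : 0 ≤ O.σ := by
  have := O.c_pos
  have := O.l2_pos
  have := M_nonneg (O := O)
  rw [σ_eq]
  positivity

theorem l2_mul_M_le : O.l2 * O.M ≤ O.σ := by
  have := O.c_pos
  have := O.l2_pos
  have := M_nonneg (O := O)
  rw [σ_eq]
  exact le_add_of_nonneg_left (by positivity)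

theorem l2_mul_M_le_c_mul : O.l2 * O.M ≤ O.c * O.σ := by
  have := O.c_pos
  have := O.l2_pos
  have := M_nonneg (O := O)
  have h : O.c * O.σ = O.l2 * O.M + O.c * (O.l2 * O.M) := by
    rw [σ_eq]; field_simp
  rw [h]
  exact le_add_of_nonneg_right (by positivity)

theorem lq_mul_lp_le : O.lq * O.lp ≤ O.c * O.M := by
  have h : O.c * O.M = O.ls + O.lp * O.lq := mul_div_cancel₀ _ O.c_pos.ne'
  rw [h]
  linarith [O.ls_nonneg]

/-- The left side is what the difference estimate produces: `l2 * M` from convection and `l2 * lq *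
lp` from buoyancy. -/
theorem l2_mul_add_le : O.l2 * (O.M + O.lq * O.lp) ≤ O.c * O.σ := by
  have h : O.c * O.σ = O.l2 * O.M + O.l2 * (O.c * O.M) := by
    have := O.c_pos.ne'
    rw [σ_eq]; field_simp
  rw [h, mul_add]
  exact add_le_add le_rfl (mul_le_mul_of_nonneg_left lq_mul_lp_le O.l2_pos.le)

theorem l2_mul_lq_mul_lp_le : O.l2 * (O.lq * O.lp) ≤ O.c * O.σ := by
  refine le_trans ?_ l2_mul_add_le
  rw [mul_add]
  exact le_add_of_nonneg_left (mul_nonneg O.l2_pos.le M_nonneg)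

theorem eq_zero_of_N {η : H} (h : O.N η = 0) : η = 0 := by
  have := O.norm_le η
  rw [h, mul_zero] at this
  exact norm_le_zero_iff.1 this

theorem le_of_mul_self_le {a b : ℝ} (ha : 0 ≤ a) (hb : 0 ≤ b) (h : a ^ 2 ≤ b * a) : a ≤ b := by
  rcases ha.eq_or_lt with rfl | ha
  · exact hb
  · rw [sq] at h
    exact le_of_mul_le_mul_right h ha

/-- Testing with the temperature itself removes the transport term by skew-symmetry, so the bound is
uniform in `w`. -/
theorem Step.NZ_le {w : H} {x : H × P × Z} (h : O.Step w x) : O.NZ x.2.2 ≤ O.lp := by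
  refine le_of_mul_self_le (O.NZ_nonneg _) O.lp_nonneg ?_
  have := h.2.2.2 _ h.1.2.2
  rw [O.Hf_self, add_zero, O.e_self] at this
  rw [this]
  exact O.φ_le _

/-- Testing with `x.1` removes `A1` by skew-symmetry and `B` by the constraint; coercivity then
absorbs the rest. -/
theorem Step.N_le {w : H} {x : H × P × Z} (h : O.Step w x) : O.N x.1 ≤ O.M := by
  have hc := O.c_pos
  have h1 := O.coercive _ h.1.1 h.2.2.1
  have h2 := h.2.1 _ h.1.1
  rw [O.A1_self, h.2.2.1 _ h.1.2.1, add_zero, add_zero] at h2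
  have h3 := O.L_le x.1
  have h4 := (abs_le.1 (O.Q_le x.2.2 x.1)).1
  have h5 : O.lq * O.NZ x.2.2 * O.N x.1 ≤ O.lp * O.lq * O.N x.1 := by
    rw [mul_comm O.lp]
    exact mul_le_mul_of_nonneg_right (mul_le_mul_of_nonneg_left h.NZ_le O.lq_nonneg)
      (O.N_nonneg _)
  refine le_of_mul_self_le (O.N_nonneg _) M_nonneg ?_
  have h6 : O.M * O.N x.1 = (O.ls * O.N x.1 + O.lp * O.lq * O.N x.1) / O.c := by
    rw [M]; ring
  rw [h6, le_div_iff₀ hc]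
  linarith

theorem Step.A1_le {w : H} {x : H × P × Z} (hx : O.Step w x) (v Φ : H) :
    |O.A1 v x.1 Φ| ≤ O.l2 * O.M * O.N v * O.N Φ := by
  refine (O.A1_le _ _ _).trans (mul_le_mul_of_nonneg_right ?_ (O.N_nonneg _))
  exact (mul_le_mul_of_nonneg_left hx.N_le
    (mul_nonneg O.l2_pos.le (O.N_nonneg _))).trans_eq (by ring)

section Difference

variable {w w' : H} {x y : H × P × Z} (hx : O.Step w x) (hy : O.Step w' y)
include hx hy

/-- The splitting keeps `w'` on the difference, where testing removes it, and `w - w'` on `x`, for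
which an a priori bound is known. -/
theorem Step.sub_heat {r : Z} (hr : r ∈ O.T) :
    O.e (x.2.2 - y.2.2) r + O.Hf w' (x.2.2 - y.2.2) r + O.Hf (w - w') x.2.2 r = 0 := by
  have h1 := hx.2.2.2 r hr
  have h2 := hy.2.2.2 r hr
  simp only [map_sub, LinearMap.sub_apply, O.Hf_sub]
  linarith

theorem Step.sub_flow {Φ : H} (hΦ : Φ ∈ O.U) :
    O.A0 (x.1 - y.1) Φ + O.A1 w' (x.1 - y.1) Φ + O.A1 (w - w') x.1 Φ
      + O.B (x.2.1 - y.2.1) Φ + O.Q (x.2.2 - y.2.2) Φ = 0 := by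
  have h1 := hx.2.1 Φ hΦ
  have h2 := hy.2.1 Φ hΦ
  simp only [map_sub, LinearMap.sub_apply, O.A1_sub]
  linarith

theorem Step.NZ_sub_le : O.NZ (x.2.2 - y.2.2) ≤ O.l2 * O.N (w - w') * O.lp := by
  have h0 : 0 ≤ O.l2 * O.N (w - w') := mul_nonneg O.l2_pos.le (O.N_nonneg _)
  refine le_of_mul_self_le (O.NZ_nonneg _) (mul_nonneg h0 O.lp_nonneg) ?_
  have h1 := hx.sub_heat hy (O.T.sub_mem hx.1.2.2 hy.1.2.2)
  rw [O.Hf_self, O.e_self] at h1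
  have h2 := (abs_le.1 (O.Hf_le (w - w') x.2.2 (x.2.2 - y.2.2))).1
  have h3 := mul_le_mul_of_nonneg_right (mul_le_mul_of_nonneg_left hx.NZ_le h0)
    (O.NZ_nonneg (x.2.2 - y.2.2))
  linarith

theorem Step.Q_sub_le (Φ : H) :
    |O.Q (x.2.2 - y.2.2) Φ| ≤ O.l2 * (O.lq * O.lp) * O.N (w - w') * O.N Φ := by
  refine (O.Q_le _ _).trans (mul_le_mul_of_nonneg_right ?_ (O.N_nonneg _))
  exact (mul_le_mul_of_nonneg_left (hx.NZ_sub_le hy) O.lq_nonneg).trans_eq (by ring)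

/-- This is the contraction estimate. Testing with the difference leaves only the terms driven by `w
- w'`: convection of `x` and buoyancy of the temperature difference. -/
theorem Step.N_sub_le : O.N (x.1 - y.1) ≤ O.σ * O.N (w - w') := by
  have hc := O.c_pos
  have hmem := O.U.sub_mem hx.1.1 hy.1.1
  have hB : ∀ χ ∈ O.W, O.B χ (x.1 - y.1) = 0 := fun χ hχ => by
    rw [map_sub, hx.2.2.1 χ hχ, hy.2.2.1 χ hχ, sub_zero]
  have h1 := O.coercive _ hmem hB
  have h2 := hx.sub_flow hy hmem
  rw [O.A1_self, hB _ (O.W.sub_mem hx.1.2.1 hy.1.2.1)] at h2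
  have h3 := (abs_le.1 (hx.Q_sub_le hy (x.1 - y.1))).1
  have h4 := (abs_le.1 (hx.A1_le (w - w') (x.1 - y.1))).1
  have h5 := mul_le_mul_of_nonneg_right (l2_mul_add_le (O := O))
    (mul_nonneg (O.N_nonneg (w - w')) (O.N_nonneg (x.1 - y.1)))
  refine le_of_mul_self_le (O.N_nonneg _) (mul_nonneg σ_nonneg (O.N_nonneg _)) ?_
  refine le_of_mul_le_mul_left ?_ hc
  linarith

/-- For a general test function `A1 w'` does not vanish, so `N w'` enters the estimate. -/
theorem Step.B_sub_le {Φ : H} (hΦ : Φ ∈ O.U) : O.B (x.2.1 - y.2.1) Φ ≤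
    ((O.CM + O.l2 * O.N w') * O.N (x.1 - y.1)
      + (O.l2 * O.M + O.l2 * (O.lq * O.lp)) * O.N (w - w')) * O.N Φ := by
  have h1 := hx.sub_flow hy hΦ
  have h2 := (abs_le.1 (hx.Q_sub_le hy Φ)).1
  have h3 := (abs_le.1 (hx.A1_le (w - w') Φ)).1
  have h4 := (abs_le.1 (O.A0_le (x.1 - y.1) Φ)).1
  have h5 := (abs_le.1 (O.A1_le w' (x.1 - y.1) Φ)).1
  linarith

end Difference

/-- With equal `w` the difference estimates are zero; the remaining equation for the multiplier is
settled by `B_injective`. -/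
theorem Step.unique {w : H} {x y : H × P × Z} (hx : O.Step w x) (hy : O.Step w y) : x = y := by
  have h1 := hx.N_sub_le hy
  have h2 := hx.NZ_sub_le hy
  rw [sub_self, O.N_zero, mul_zero] at h1
  rw [sub_self, O.N_zero, mul_zero, zero_mul] at h2
  have e1 := eq_zero_of_N (le_antisymm h1 (O.N_nonneg _))
  have e2 := O.NZ_eq_zero _ (le_antisymm h2 (O.NZ_nonneg _))
  have e3 : x.2.1 - y.2.1 = 0 := by
    refine O.B_injective _ (O.W.sub_mem hx.1.2.1 hy.1.2.1) fun Φ hΦ => ?_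
    have := hx.sub_flow hy hΦ
    rw [O.A1_sub, sub_self, e1, e2] at this
    simpa using this
  exact Prod.ext (sub_eq_zero.1 e1) (Prod.ext (sub_eq_zero.1 e3) (sub_eq_zero.1 e2))

variable (O) in
/-- The bilinear form of the linearized problem on the discrete spaces. -/
def systemForm (w : H) : (O.U × O.W × O.T) →ₗ[ℝ] Module.Dual ℝ (O.U × O.W × O.T) :=
  LinearMap.mk₂ ℝ (fun x y => O.A0 x.1 y.1 + O.A1 w x.1 y.1 + O.B x.2.1 y.1 + O.Q x.2.2 y.1
      + O.B y.2.1 x.1 + (O.e x.2.2 y.2.2 + O.Hf w x.2.2 y.2.2))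
    (fun a b y => by simp; ring) (fun a b y => by simp; ring)
    (fun a b y => by simp; ring) (fun a b y => by simp; ring)

theorem systemForm_apply (w : H) (x y : O.U × O.W × O.T) :
    O.systemForm w x y = O.A0 x.1 y.1 + O.A1 w x.1 y.1 + O.B x.2.1 y.1 + O.Q x.2.2 y.1
      + O.B y.2.1 x.1 + (O.e x.2.2 y.2.2 + O.Hf w x.2.2 y.2.2) := rfl

variable (O) in
/-- The same system with zero right-hand sides. -/
def homogeneous : OseenSystem H P Z :=
  { O with
    L := 0
    φ := 0
    L_le := fun Φ => by
      simpa using mul_nonneg O.ls_nonneg (O.N_nonneg Φ)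
    φ_le := fun r => by
      simpa using mul_nonneg O.lp_nonneg (O.NZ_nonneg r) }

/-- Test vectors supported in a single component separate the equations. `L` and `φ` are free so
that the homogeneous problem is covered too. -/
theorem step_of_systemForm_eq {w : H} {x : O.U × O.W × O.T} {L : H →ₗ[ℝ] ℝ} {φ : Z →ₗ[ℝ] ℝ}
    (h : ∀ y : O.U × O.W × O.T, O.systemForm w x y = L y.1 + φ y.2.2) :
    (∀ Φ ∈ O.U, O.A0 x.1 Φ + O.A1 w x.1 Φ + O.B x.2.1 Φ + O.Q x.2.2 Φ = L Φ) ∧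
    (∀ χ ∈ O.W, O.B χ x.1 = 0) ∧
    (∀ r ∈ O.T, O.e x.2.2 r + O.Hf w x.2.2 r = φ r) := by
  refine ⟨fun Φ hΦ => ?_, fun χ hχ => ?_, fun r hr => ?_⟩
  · simpa [systemForm_apply] using h (⟨Φ, hΦ⟩, 0, 0)
  · simpa [systemForm_apply] using h (0, ⟨χ, hχ⟩, 0)
  · simpa [systemForm_apply] using h (0, 0, ⟨r, hr⟩)

/-- A kernel element solves the homogeneous problem, which is again an `OseenSystem`, so
`Step.unique` compares it with `0`. -/
theorem systemForm_injective (w : H) : Function.Injective (O.systemForm w) := by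
  rw [← LinearMap.ker_eq_bot, LinearMap.ker_eq_bot']
  intro x hx
  have h1 := step_of_systemForm_eq (O := O) (w := w) (x := x) (L := 0) (φ := 0)
    fun y => by simp [hx]
  have h2 : O.homogeneous.Step w (x.1, x.2.1, x.2.2) :=
    ⟨⟨x.1.2, x.2.1.2, x.2.2.2⟩, h1⟩
  have h3 : O.homogeneous.Step w 0 := by
    refine ⟨⟨zero_mem _, zero_mem _, zero_mem _⟩, fun Φ _ => ?_, fun χ _ => ?_, fun r _ => ?_⟩ <;>
      simp [homogeneous]
  have h4 := h2.unique h3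
  simp only [Prod.mk_eq_zero, ZeroMemClass.coe_eq_zero] at h4
  exact Prod.ext h4.1 (Prod.ext h4.2.1 h4.2.2)

variable (O) in
theorem exists_step (w : H) : ∃ x, O.Step w x := by
  have := O.finU
  have := O.finW
  have := O.finT
  -- The discrete space and its dual have equal finite dimension, so injectivity gives surjectivity.
  have hs : Function.Surjective (O.systemForm w) :=
    (LinearMap.injective_iff_surjective_of_finrank_eq_finrank
      Subspace.dual_finrank_eq.symm).1 (systemForm_injective w)
  obtain ⟨x, hx⟩ := hs ((O.L.comp (O.U.subtype.comp (LinearMap.fst ℝ _ _)))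
    + O.φ.comp (O.T.subtype.comp ((LinearMap.snd ℝ _ _).comp (LinearMap.snd ℝ _ _))))
  refine ⟨(x.1, x.2.1, x.2.2), ⟨x.1.2, x.2.1.2, x.2.2.2⟩, step_of_systemForm_eq fun y => ?_⟩
  rw [hx]
  rfl

variable (O) in
/-- The Oseen iteration. -/
def IsIteration (it : ℕ → H × P × Z) : Prop :=
  O.Step 0 (it 0) ∧ ∀ n, O.Step (it n).1 (it (n + 1))

variable (O) in
theorem existsUnique_iteration : ∃! it, O.IsIteration it := by
  choose F hF using O.exists_step
  refine ⟨fun n => Nat.rec (F 0) (fun _ x => F x.1) n, ⟨hF 0, fun n => hF _⟩, fun it hit => ?_⟩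
  funext n
  induction n with
  | zero => exact hit.1.unique (hF 0)
  | succ n ih =>
    have := hit.2 n
    rw [ih] at this
    exact this.unique (hF _)

theorem solution_unique (hσ : O.σ < 1) {x y : H × P × Z} (hx : O.Step x.1 x)
    (hy : O.Step y.1 y) : x = y := by
  have h1 := hx.N_sub_le hy
  have h2 : x.1 - y.1 = 0 := by
    refine eq_zero_of_N (le_antisymm ?_ (O.N_nonneg _))
    have := O.N_nonneg (x.1 - y.1)
    nlinarith
  rw [← sub_eq_zero.1 h2] at hy
  exact hx.unique hy

/-- Banach's fixed point argument: the iterates are Cauchy in `U`, and the step linearized at their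
limit reproduces that limit. -/
theorem exists_solution (hσ : O.σ < 1) : ∃ x : H × P × Z, O.Step x.1 x := by
  have := O.finU
  obtain ⟨it, ⟨-, hit⟩, -⟩ := O.existsUnique_iteration
  have hstep : ∀ n, O.N ((it n).1 - (it (n + 1)).1) ≤
      O.N ((it 0).1 - (it 1).1) * O.σ ^ n := by
    intro n
    induction n with
    | zero => simp
    | succ n ih =>
      refine ((hit n).N_sub_le (hit (n + 1))).trans ?_
      refine (mul_le_mul_of_nonneg_left ih σ_nonneg).trans_eq ?_
      ring
  have hdist : ∀ n, dist (it n).1 (it (n + 1)).1 ≤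
      |O.K| * O.N ((it 0).1 - (it 1).1) * O.σ ^ n := by
    intro n
    rw [dist_eq_norm, mul_assoc]
    refine (O.norm_le _).trans ?_
    exact mul_le_mul (le_abs_self _) (hstep n) (O.N_nonneg _) (abs_nonneg _)
  -- The shift by one matches `hit n`, which places the iterate `n + 1` in `U`.
  have hcauchy : CauchySeq fun n => (it (n + 1)).1 :=
    (cauchySeq_of_le_geometric _ _ hσ hdist).comp_tendsto (tendsto_add_atTop_nat 1)
  obtain ⟨η, -, hη⟩ := cauchySeq_tendsto_of_isComplete
    (Submodule.complete_of_finiteDimensional O.U) (fun n => (hit n).1.1) hcauchy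
  obtain ⟨x, hx⟩ := O.exists_step η
  have h1 : Tendsto (fun n => O.N (x.1 - (it (n + 1 + 1)).1)) atTop (𝓝 (O.N (x.1 - η))) :=
    (O.N_continuous.tendsto _).comp
      (tendsto_const_nhds.sub (hη.comp (tendsto_add_atTop_nat 1)))
  have h2 : Tendsto (fun n => O.σ * O.N (η - (it (n + 1)).1)) atTop (𝓝 0) := by
    have := ((O.N_continuous.tendsto _).comp
      ((tendsto_const_nhds (x := η)).sub hη)).const_mul O.σ
    rwa [sub_self, O.N_zero, mul_zero] at this
  -- The contraction estimate compares `x`, linearized at `η`, with the iterates; passing to the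
  -- limit forces `x.1 = η`.
  have h3 : O.N (x.1 - η) ≤ 0 := le_of_tendsto_of_tendsto' h1 h2 fun n => hx.N_sub_le (hit (n + 1))
  have h4 := sub_eq_zero.1 (eq_zero_of_N (le_antisymm h3 (O.N_nonneg _)))
  rw [← h4] at hx
  exact ⟨x, hx⟩

theorem error_bound_nonneg (n : ℕ) : 0 ≤ (O.CM + 3 * O.c) * O.σ ^ n * O.M :=
  mul_nonneg (mul_nonneg (add_nonneg O.CM_nonneg (mul_nonneg zero_le_three O.c_pos.le))
    (pow_nonneg σ_nonneg _)) M_nonneg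

/-- Errors after one step in terms of the previous error. -/
theorem Step.error_le (hσ : O.σ < 1) {w : H} {x y : H × P × Z} {n : ℕ} (hx : O.Step x.1 x)
    (hy : O.Step w y) (hw : O.N w ≤ O.M) (hxw : O.N (x.1 - w) ≤ O.σ ^ n * O.M) :
    O.N (x.1 - y.1) ≤ O.σ ^ (n + 1) * O.M ∧
    O.NZ (x.2.2 - y.2.2) ≤ O.σ ^ (n + 1) * O.lp ∧
    ∀ Φ ∈ O.U, O.B (x.2.1 - y.2.1) Φ ≤
      (O.CM + 3 * O.c) * O.σ ^ (n + 1) * O.M * O.N Φ := by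
  have hc := O.c_pos
  have hM := M_nonneg (O := O)
  have hs := σ_nonneg (O := O)
  have hl := O.l2_pos
  have hsn := pow_nonneg hs n
  have h1 : O.N (x.1 - y.1) ≤ O.σ ^ (n + 1) * O.M :=
    (hx.N_sub_le hy).trans ((mul_le_mul_of_nonneg_left hxw hs).trans_eq (by ring))
  refine ⟨h1, ?_, fun Φ hΦ => ?_⟩
  · refine (hx.NZ_sub_le hy).trans (mul_le_mul_of_nonneg_right ?_ O.lp_nonneg)
    calc O.l2 * O.N (x.1 - w) ≤ O.l2 * (O.σ ^ n * O.M) := mul_le_mul_of_nonneg_left hxw hl.le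
      _ = O.σ ^ n * (O.l2 * O.M) := by ring
      _ ≤ O.σ ^ n * O.σ := mul_le_mul_of_nonneg_left l2_mul_M_le hsn
      _ = _ := (pow_succ _ _).symm
  · refine (hx.B_sub_le hy hΦ).trans (mul_le_mul_of_nonneg_right ?_ (O.N_nonneg Φ))
    -- `l2 * N w ≤ l2 * M ≤ c * σ ≤ c` supplies one `c`; `h3` supplies the other two in `CM + 3 *
    -- c`.
    have h2 : O.l2 * O.N w ≤ O.c := by
      refine (mul_le_mul_of_nonneg_left hw hl.le).trans (l2_mul_M_le_c_mul.trans ?_)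
      nlinarith
    have h3 : O.l2 * O.M + O.l2 * (O.lq * O.lp) ≤ 2 * (O.c * O.σ) := by
      have := l2_mul_M_le_c_mul (O := O)
      have := l2_mul_lq_mul_lp_le (O := O)
      linarith
    have hCM := O.CM_nonneg
    calc _ ≤ (O.CM + O.c) * (O.σ ^ (n + 1) * O.M) + 2 * (O.c * O.σ) * (O.σ ^ n * O.M) := by
          refine add_le_add (mul_le_mul (by linarith) h1 (O.N_nonneg _) (by positivity))
            (mul_le_mul h3 hxw (O.N_nonneg _) (by positivity))
      _ = _ := by ring

theorem iteration_error_le (hσ : O.σ < 1) {x : H × P × Z} (hx : O.Step x.1 x)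
    {it : ℕ → H × P × Z} (hit : O.IsIteration it) (n : ℕ) :
    O.NZ (it n).2.2 ≤ O.lp ∧ O.N (it n).1 ≤ O.M ∧
    O.N (x.1 - (it n).1) ≤ O.σ ^ (n + 1) * O.M ∧
    O.NZ (x.2.2 - (it n).2.2) ≤ O.σ ^ (n + 1) * O.lp ∧
    ∀ Φ ∈ O.U, O.B (x.2.1 - (it n).2.1) Φ ≤
      (O.CM + 3 * O.c) * O.σ ^ (n + 1) * O.M * O.N Φ := by
  induction n with
  | zero =>
    -- The initial problem is a step from `w = 0`, whose error `N x.1 ≤ M` is `σ ^ 0 * M`; hence the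
    -- exponent `n + 1`.
    refine ⟨hit.1.NZ_le, hit.1.N_le, hx.error_le hσ hit.1 ?_ ?_⟩
    · rw [O.N_zero]; exact M_nonneg
    · simpa using hx.N_le
  | succ n ih =>
    exact ⟨(hit.2 n).NZ_le, (hit.2 n).N_le, hx.error_le hσ (hit.2 n) ih.2.1 ih.2.2.1⟩

end OseenSystem

/-! ### The inf-sup condition and the passage to the abstract system. -/

theorem velGradNorm_smul (c : ℝ) (v : Vel Ω) : velGradNorm (c • v) = |c| * velGradNorm v := by
  have h : ∀ i, ‖grad ((c • v) i)‖ ^ 2 = |c| ^ 2 * ‖grad (v i)‖ ^ 2 := fun i => by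
    rw [Pi.smul_apply, grad_smul, norm_smul, mul_pow, Real.norm_eq_abs]
  unfold velGradNorm
  rw [Finset.sum_congr rfl fun i _ => h i, ← Finset.mul_sum,
    Real.sqrt_mul (sq_nonneg _), Real.sqrt_sq (abs_nonneg _)]

theorem divNorm_smul (c : ℝ) (K : H0div Ω) : divNorm (c • K) = |c| * divNorm K := by
  unfold divNorm
  rw [vec_smul, wdiv_smul, norm_smul, norm_smul, mul_pow, mul_pow, ← mul_add,
    Real.sqrt_mul (sq_nonneg _), Real.sqrt_sq (norm_nonneg _), Real.norm_eq_abs]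

theorem norm0_nonneg (χ : L20 Ω × L20 Ω) : 0 ≤ norm0 χ := Real.sqrt_nonneg _

theorem sq_norm0 (χ : L20 Ω × L20 Ω) : norm0 χ ^ 2 = ‖χ.1‖ ^ 2 + ‖χ.2‖ ^ 2 :=
  Real.sq_sqrt (by positivity)

theorem eq_zero_of_norm0 {χ : L20 Ω × L20 Ω} (h : norm0 χ = 0) : χ = 0 := by
  have h1 := sq_norm0 χ
  rw [h] at h1
  have h2 : ‖χ.1‖ = 0 := by nlinarith [sq_nonneg ‖χ.1‖, sq_nonneg ‖χ.2‖]
  have h3 : ‖χ.2‖ = 0 := by nlinarith [sq_nonneg ‖χ.1‖, sq_nonneg ‖χ.2‖]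
  exact Prod.ext (norm_eq_zero.1 h2) (norm_eq_zero.1 h3)

/-- A vector with norm `a` almost realizing an inf-sup constant. -/
theorem exists_norm_eq_of_infSup {E : Type*} [AddCommGroup E] [Module ℝ E] {X : Submodule ℝ E}
    {f : E →ₗ[ℝ] ℝ} {N : E → ℝ} (hN : ∀ v, 0 ≤ N v) (hN0 : ∀ v, N v = 0 → v = 0)
    (hNs : ∀ (c : ℝ) v, N (c • v) = |c| * N v) {a β β' : ℝ} (ha : 0 ≤ a) (hβ : 0 < β)
    (hβ' : β' < β) (h : a ≠ 0 → β ≤ sSup {t | ∃ w ∈ X, w ≠ 0 ∧ t = f w / (N w * a)}) :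
    ∃ v ∈ X, N v = a ∧ β' * a ^ 2 ≤ f v := by
  rcases ha.eq_or_lt with rfl | ha
  · refine ⟨0, X.zero_mem, ?_, by simp⟩
    have := hNs 0 0
    simpa using this
  · have h1 := hβ'.trans_le (h ha.ne')
    have hne : {t | ∃ w ∈ X, w ≠ 0 ∧ t = f w / (N w * a)}.Nonempty := by
      -- Over an empty set the real `sSup` is `0`, contradicting `0 < β`.
      by_contra hemp
      rw [Set.not_nonempty_iff_eq_empty] at hemp
      have := h ha.ne'
      rw [hemp, Real.sSup_empty] at this
      linarith
    obtain ⟨_, ⟨w, hw, hw0, rfl⟩, hlt⟩ := exists_lt_of_lt_csSup hne h1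
    have hNw : 0 < N w := lt_of_le_of_ne (hN w) fun h0 => hw0 (hN0 w h0.symm)
    refine ⟨(a / N w) • w, X.smul_mem _ hw, ?_, ?_⟩
    · rw [hNs, abs_of_pos (div_pos ha hNw), div_mul_cancel₀ _ hNw.ne']
    · rw [lt_div_iff₀ (mul_pos hNw ha)] at hlt
      rw [map_smul, smul_eq_mul, div_mul_eq_mul_div, le_div_iff₀ hNw]
      nlinarith

theorem finiteDimensional_prod {E F : Type*} [AddCommGroup E] [Module ℝ E] [AddCommGroup F]
    [Module ℝ F] {X : Submodule ℝ E} {Y : Submodule ℝ F} (hX : FiniteDimensional ℝ X)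
    (hY : FiniteDimensional ℝ Y) : FiniteDimensional ℝ (X.prod Y) :=
  Module.Finite.iff_fg.2 ((Module.Finite.iff_fg.1 hX).prod (Module.Finite.iff_fg.1 hY))

namespace Spaces

variable {lam1 lam2 CΩ : ℝ} (h : SobolevConstants Ω lam1 lam2 CΩ) {D : Data Ω} {V : Spaces Ω}
include h

/-- The two inf-sup conditions imply the inf-sup condition for the sum. -/
theorem infSup_min {βs βm : ℝ} (hβs : 0 < βs) (hβm : 0 < βm) (hs : V.InfSupS D βs)
    (hm : V.InfSupM D βm) : V.InfSup D (min βs βm) := by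
  intro χ hχ
  set A := {t | ∃ Φ ∈ V.X.prod V.Y, Φ ≠ 0 ∧ t = D.Bform χ Φ / norm1 Φ} with hA
  rcases (norm0_nonneg χ).eq_or_lt with h0 | h0
  · rw [← h0, mul_zero]
    refine Real.sSup_nonneg ?_
    rintro _ ⟨Φ, -, -, rfl⟩
    have h1 : D.Bform χ Φ = 0 := by
      rw [eq_zero_of_norm0 h0.symm, ← D.bLin_apply, map_zero, LinearMap.zero_apply]
    rw [h1, zero_div]
  -- A constant below the minimum avoids the question whether the suprema are attained. Choosing `v`
  -- and `K` with the norms of `χ.1` and `χ.2` makes `norm1 (v, K) = norm0 χ`, so the two bounds add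
  -- up.
  · have key : ∀ β' < min βs βm, β' * norm0 χ ≤ sSup A := by
      intro β' hβ'
      obtain ⟨v, hv, hv1, hv2⟩ := exists_norm_eq_of_infSup (X := V.X) (f := D.bSLin χ.1)
        (N := velGradNorm) velGradNorm_nonneg (fun _ => h.eq_zero_of_velGradNorm)
        velGradNorm_smul (norm_nonneg χ.1) hβs (hβ'.trans_le (min_le_left _ _))
        fun hq => hs χ.1 hχ.1 (norm_ne_zero_iff.1 hq)
      obtain ⟨K, hK, hK1, hK2⟩ := exists_norm_eq_of_infSup (X := V.Y) (f := D.bMLin χ.2)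
        (N := divNorm) divNorm_nonneg (fun _ => SobolevConstants.eq_zero_of_divNorm)
        divNorm_smul (norm_nonneg χ.2) hβm (hβ'.trans_le (min_le_right _ _))
        fun hq => hm χ.2 hχ.2 (norm_ne_zero_iff.1 hq)
      have hN : norm1 (v, K) = norm0 χ := by
        unfold norm1 norm0
        rw [hv1, hK1]
      have hne : ((v, K) : Vel Ω × H0div Ω) ≠ 0 := fun h1 => by
        rw [h1, norm1_zero] at hN
        exact h0.ne hN
      refine le_trans ?_ (le_csSup ⟨D.Pr * d * ‖χ.1‖ + D.κ * ‖χ.2‖, ?_⟩ ⟨(v, K), ⟨hv, hK⟩, hne, rfl⟩)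
      · rw [hN, le_div_iff₀ h0, mul_assoc, ← sq, sq_norm0, mul_add]
        exact add_le_add hv2 hK2
      · rintro _ ⟨Φ, -, hΦ, rfl⟩
        have hpos : 0 < norm1 Φ :=
          lt_of_le_of_ne (norm1_nonneg Φ) fun h1 => hΦ (h.eq_zero_of_norm1 h1.symm)
        rw [div_le_iff₀ hpos]
        exact D.Bform_le χ Φ
    by_contra! hlt
    rw [← div_lt_iff₀ h0] at hlt
    obtain ⟨β', h1, h2⟩ := exists_between hlt
    rw [div_lt_iff₀ h0] at h1
    exact absurd (key β' h2) h1.not_ge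

omit h in
theorem InfSup.le_of_forall {β C : ℝ} (hβ : V.InfSup D β) (hC : 0 ≤ C) {χ : L20 Ω × L20 Ω}
    (hχ : χ ∈ V.E.prod V.S) (hB : ∀ Φ ∈ V.X.prod V.Y, D.Bform χ Φ ≤ C * norm1 Φ) :
    β * norm0 χ ≤ C := by
  refine (hβ χ hχ).trans (Real.sSup_le ?_ hC)
  rintro _ ⟨Φ, hΦ, -, rfl⟩
  rcases (norm1_nonneg Φ).eq_or_lt with h0 | h0
  · rw [← h0, _root_.div_zero]; exact hC
  · rw [div_le_iff₀ h0]; exact hB Φ hΦ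

omit h in
theorem InfSup.eq_zero {β : ℝ} (hβ0 : 0 < β) (hβ : V.InfSup D β) {χ : L20 Ω × L20 Ω}
    (hχ : χ ∈ V.E.prod V.S) (hB : ∀ Φ ∈ V.X.prod V.Y, D.Bform χ Φ = 0) : χ = 0 := by
  have h1 := hβ.le_of_forall le_rfl hχ fun Φ hΦ => by rw [hB Φ hΦ, zero_mul]
  refine eq_zero_of_norm0 (le_antisymm ?_ (norm0_nonneg χ))
  by_contra! h2
  exact absurd h1 (mul_pos hβ0 h2).not_ge

omit h in
/-- Discretely divergence free magnetic fields are divergence free. -/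
theorem ChargeConservative.wdiv_eq_zero (hV : V.ChargeConservative) {η : Vel Ω × H0div Ω}
    (hη : η ∈ V.X.prod V.Y) (hB : ∀ χ ∈ V.E.prod V.S, D.Bform χ η = 0) : wdiv η.2 = 0 := by
  obtain ⟨s, hs, hsη⟩ := hV η.2 hη.2
  have h1 := hB (0, s) ⟨V.E.zero_mem, hs⟩
  have h2 : D.bS 0 η.1 = 0 := by
    rw [← D.bSLin_apply, map_zero, LinearMap.zero_apply]
  have h3 : D.Bform (0, s) η = -D.κ * inner ℝ (wdiv η.2) (wdiv η.2) := by
    rw [Data.Bform, h2, zero_add, Data.bM, hsη]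
  rw [h3] at h1
  have h4 := (mul_eq_zero.1 h1).resolve_left (neg_ne_zero.2 D.κ_pos.ne')
  exact inner_self_eq_zero.1 h4

/-- The discrete magnetohydrodynamic problem as an `OseenSystem`. -/
def oseenSystem (hd : d = 2 ∨ d = 3) (D : Data Ω) (V : Spaces Ω) (hV : V.ChargeConservative)
    {β : ℝ} (hβ0 : 0 < β) (hβ : V.InfSup D β) :
    OseenSystem (Vel Ω × H0div Ω) (L20 Ω × L20 Ω) (H01 Ω) where
  A0 := D.a0Lin h hd
  A1 := h.a1Lin
  B := D.bLin
  Q := D.qLin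
  e := eLin
  Hf := h.hLin
  L := D.lLin
  φ := D.φ
  U := V.X.prod V.Y
  W := V.E.prod V.S
  T := V.Z
  finU := finiteDimensional_prod V.finX V.finY
  finW := finiteDimensional_prod V.finE V.finS
  finT := V.finZ
  N := norm1
  NZ := gradNorm
  c := D.Cmin
  CM := D.Cmax lam1
  l2 := lam2
  lq := D.lamQ CΩ
  lp := D.lamPsi
  ls := D.Lstar
  K := CΩ + 1
  c_pos := D.Cmin_pos
  CM_nonneg := mul_nonneg zero_le_two ((D.Pr_pos.le.trans (le_max_left _ _)).trans (le_max_left _ _))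
  l2_pos := h.lam2_pos
  lq_nonneg := D.lamQ_nonneg CΩ
  lp_nonneg := D.lamPsi_nonneg h
  ls_nonneg := D.Lstar_nonneg
  N_nonneg := norm1_nonneg
  NZ_nonneg := gradNorm_nonneg
  N_zero := norm1_zero
  norm_le := h.norm_le_norm1
  N_continuous := continuous_norm1
  NZ_eq_zero _ := h.eq_zero_of_gradNorm
  A1_sub w w' η Φ := by
    linear_combination h.a1Lin_apply (w - w') η Φ - h.a1Lin_apply w η Φ + h.a1Lin_apply w' η Φ
      + h.A1_sub w w' η Φ
  Hf_sub := h.Hform_sub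
  A1_self w η := (h.a1Lin_apply w η η).trans (sub_self _)
  Hf_self w r := sub_self _
  e_self := eForm_self
  coercive η hη hB := (D.Cmin_mul_le_A0_self (hV.wdiv_eq_zero (D := D) hη hB)).trans_eq
    (D.a0Lin_apply h hd η η).symm
  B_injective _ hχ hB := hβ.eq_zero hβ0 hχ hB
  A0_le η Φ := (congrArg abs (D.a0Lin_apply h hd η Φ)).trans_le (D.abs_A0_le h hd η Φ)
  A1_le w η Φ := (congrArg abs (h.a1Lin_apply w η Φ)).trans_le (h.abs_A1_le w η Φ)
  Hf_le := h.abs_Hform_le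
  Q_le := D.abs_Q_le h
  L_le := D.L_le h
  φ_le := D.φ_le h

section Equivalence

variable (hd : d = 2 ∨ d = 3) (hV : V.ChargeConservative) {β : ℝ} (hβ0 : 0 < β)
  (hβ : V.InfSup D β)

theorem sum_forms_eq (w : Vel Ω × H0div Ω) (s : State Ω) (Φ : Vel Ω × H0div Ω) :
    D.A0 s.η Φ + A1 w s.η Φ + D.Bform s.ξ Φ + D.Q s.θ Φ =
      D.a0Lin h hd s.η Φ + h.a1Lin w s.η Φ + D.bLin s.ξ Φ + D.qLin s.θ Φ := by
  linear_combination -D.a0Lin_apply h hd s.η Φ - h.a1Lin_apply w s.η Φ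
      - D.bLin_apply s.ξ Φ - D.qLin_apply s.θ Φ

set_option maxHeartbeats 1000000 in
theorem isOseenStep_iff (w : Vel Ω × H0div Ω) (s : State Ω) : V.IsOseenStep D w s ↔
    (oseenSystem h hd D V hV hβ0 hβ).Step w (s.η, s.ξ, s.θ) := by
  have e := sum_forms_eq h hd (D := D) w s
  change _ ↔ V.Mem s ∧ (∀ Φ ∈ V.X.prod V.Y, D.a0Lin h hd s.η Φ + h.a1Lin w s.η Φ
      + D.bLin s.ξ Φ + D.qLin s.θ Φ = D.L Φ) ∧ (∀ χ ∈ V.E.prod V.S, D.Bform χ s.η = 0) ∧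
    (∀ r ∈ V.Z, eForm s.θ r + Hform w s.θ r = D.φ r)
  unfold IsOseenStep
  refine and_congr_right fun _ => and_congr_left fun _ => forall₂_congr fun Φ _ => ?_
  rw [e Φ]

/-- `A1` and `Hform` vanish when linearized at zero, so the initial problem needs no separate
treatment. -/
theorem isInitial_iff (s : State Ω) : V.IsInitial D s ↔ V.IsOseenStep D 0 s := by
  have e1 : ∀ Φ, A1 0 s.η Φ = 0 := fun Φ => by
    have := h.A1_sub 0 0 s.η Φ
    rwa [sub_self, sub_self] at this
  have e2 : ∀ r, Hform 0 s.θ r = 0 := fun r => by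
    have := h.Hform_sub 0 0 s.θ r
    rwa [sub_self, sub_self] at this
  unfold IsInitial IsOseenStep
  simp only [e1, e2, add_zero]

theorem isOseenIteration_iff (it : ℕ → State Ω) : V.IsOseenIteration D it ↔
    (oseenSystem h hd D V hV hβ0 hβ).IsIteration
      fun n => ((it n).η, (it n).ξ, (it n).θ) :=
  and_congr ((isInitial_iff h (it 0)).trans (isOseenStep_iff h hd hV hβ0 hβ 0 (it 0)))
    (forall_congr' fun n => isOseenStep_iff h hd hV hβ0 hβ _ (it (n + 1)))

end Equivalence

end Spaces

end IMHD

end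

/-! ### Assembly of the result. -/

theorem theorem4p4 {d : ℕ} (hd : d = 2 ∨ d = 3) (Ω : Set (IMHD.Pt d))
    (hΩ : IsOpen Ω) (hΩb : Bornology.IsBounded Ω) :
    (∃ lam1 lam2 CΩ : ℝ, IMHD.SobolevConstants Ω lam1 lam2 CΩ) ∧
    ∀ lam1 lam2 CΩ : ℝ, IMHD.SobolevConstants Ω lam1 lam2 CΩ →
    ∀ (D : IMHD.Data Ω) (V : IMHD.Spaces Ω), V.ChargeConservative →
    ∀ βs βm : ℝ, 0 < βs → 0 < βm → V.InfSupS D βs → V.InfSupM D βm →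
    D.sigma lam2 CΩ < 1 →
      (∃! s : IMHD.State Ω, V.IsSolution D s) ∧
      (∃! it : ℕ → IMHD.State Ω, V.IsOseenIteration D it) ∧
      V.InfSup D (min βs βm) ∧
      ∀ s : IMHD.State Ω, V.IsSolution D s →
      ∀ it : ℕ → IMHD.State Ω, V.IsOseenIteration D it → ∀ n : ℕ,
        IMHD.gradNorm (it n).θ ≤ D.lamPsi ∧
        IMHD.norm1 (it n).η ≤ (D.Lstar + D.lamPsi * D.lamQ CΩ) / D.Cmin ∧
        IMHD.norm1 (s.η - (it n).η) ≤
          D.sigma lam2 CΩ ^ (n + 1) * ((D.Lstar + D.lamQ CΩ * D.lamPsi) / D.Cmin) ∧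
        IMHD.gradNorm (s.θ - (it n).θ) ≤ D.sigma lam2 CΩ ^ (n + 1) * D.lamPsi ∧
        ∀ β : ℝ, V.InfSup D β →
          β * IMHD.norm0 (s.ξ - (it n).ξ) ≤
            (D.Cmax lam1 + 3 * D.Cmin) * D.sigma lam2 CΩ ^ (n + 1) *
              ((D.Lstar + D.lamQ CΩ * D.lamPsi) / D.Cmin) := by
  refine ⟨IMHD.exists_sobolevConstants hd hΩb, ?_⟩
  intro lam1 lam2 CΩ h D V hV βs βm hβs hβm hs hm hσ
  have hβ := IMHD.Spaces.infSup_min h hβs hβm hs hm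
  have hβ0 : 0 < min βs βm := lt_min hβs hβm
  set O := IMHD.Spaces.oseenSystem h hd D V hV hβ0 hβ with hO
  have hstep := IMHD.Spaces.isOseenStep_iff h hd hV hβ0 hβ
  have hiter := IMHD.Spaces.isOseenIteration_iff h hd hV hβ0 hβ
  have hOσ : O.σ < 1 := hσ
  refine ⟨?_, ?_, hβ, ?_⟩
  · obtain ⟨x, hx⟩ := IMHD.OseenSystem.exists_solution hOσ
    -- Solving the nonlinear problem is by definition being the result of an Oseen step from one's
    -- own velocity and magnetic field.
    refine ⟨⟨x.1, x.2.1, x.2.2⟩, (hstep x.1 ⟨x.1, x.2.1, x.2.2⟩).2 hx, fun s hsol => ?_⟩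
    have e := IMHD.OseenSystem.solution_unique hOσ ((hstep s.η s).1 hsol) hx
    rw [← e]
  · obtain ⟨it, hit, huniq⟩ := O.existsUnique_iteration
    refine ⟨fun n => ⟨(it n).1, (it n).2.1, (it n).2.2⟩, (hiter _).2 hit, fun it' hit' => ?_⟩
    have e := huniq _ ((hiter it').1 hit')
    rw [← e]
  · intro s hsol it hit n
    have hx := (hstep s.η s).1 hsol
    have hi := (hiter it).1 hit
    obtain ⟨h1, h2, h3, h4, h5⟩ := IMHD.OseenSystem.iteration_error_le hOσ hx hi n
    have hM : (D.Lstar + D.lamQ CΩ * D.lamPsi) / D.Cmin = O.M := by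
      rw [mul_comm (D.lamQ CΩ)]
      rfl
    rw [hM]
    have hmem : s.ξ - (it n).ξ ∈ V.E.prod V.S := by
      refine Submodule.sub_mem _ hx.1.2.1 ?_
      cases n with
      | zero => exact hi.1.1.2.1
      | succ n => exact (hi.2 n).1.2.1
    exact ⟨h1, h2, h3, h4, fun β hβ' =>
      hβ'.le_of_forall (IMHD.OseenSystem.error_bound_nonneg (O := O) (n + 1)) hmem h5⟩
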